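/- Let $\delta>0$, let $\Omega\subset\mathbb R^m$ be nonempty, and let $l:[0,\infty)\times\mathbb R^n\times\mathbb R^m\to\mathbb R$ and $f:[0,\infty)\times\mathbb R^n\times\mathbb R^m\to\mathbb R^n$ satisfy: - A1) there is $K_1>0$ with $|l(t,x,u)-l(t,z,u)|+|f(t,x,u)-f(t,z,u)|\le K_1|x-z|$ for all $t\ge 0$, $u\in\Omega$, $x,z\in\mathbb R^n$; - A2) there is $K_2>0$ with $|l(t,x,u)|+|f(t,x,u)|\le K_2(1+|x|)$ for all $t\ge0$, $x\in\mathbb R^n$, $u\in\Omega$; - A3) $l$ and $f$ are continuous; - A4) for all $t\ge0$, $x\in\mathbb R^n$ the set $\{(e^{-\delta t}l(t,x,v),f(t,x,v)) : v\in\Omega\}\subset\mathbb R^{1+n}$ is convex; - A5) $\Omega$ is compact. Put $\mathcal H(t,x,\xi)=\inf_{u\in\Omega}\{\langle\xi,f(t,x,u)\rangle+e^{-\delta t}l(t,x,u)\}$. For $\Phi:[0,\infty)\times\mathbb R^n\to\mathbb R$, a point $(t,x)\in[0,\infty)\times\mathbb R^n$ and a direction $(u,v)\in\mathbb R^{1+n}$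 let $$D^-\Phi(t,x;u,v)=\liminf_{r\downarrow0,\ w\to v}\frac{\Phi(t+ru,x+rw)-\Phi(t,x)}{r},\qquad D^+\Phi(t,x;u,v)=\limsup_{r\downarrow0,\ w\to v}\frac{\Phi(t+ru,x+rw)-\Phi(t,x)}{r},$$ with values in $[-\infty,+\infty]$; for $t=0$ and $u<0$, where the quotients are undefined, $D^-\Phi=+\infty$ and $D^+\Phi=-\infty$. Let - $\partial_D\Phi(t,x)$ (Dini sub-gradient) be the set of $(\alpha,\xi)\in\mathbb R^{1+n}$ with $D^-\Phi(t,x;u,v)\ge u\alpha+\langle v,\xi\rangle$ for all $(u,v)\in\mathbb R^{1+n}$; - $\partial^D\Phi(t,x)$ (Dini super-gradient) be the set of $(\alpha,\xi)\in\mathbb R^{1+n}$ with $D^+\Phi(t,x;u,v)\le u\alpha+\langle v,\xi\rangle$ for all $(u,v)\in\mathbb R^{1+n}$; - $\partial_P\Phi(t,x)$ (proximal sub-gradient) be the set of $(\alpha,\xi)\in\mathbb R^{1+n}$ for which there are $\sigma>0$ and a neighbourhood $U$ of $(t,x)$ in $[0,\infty)\times\mathbb R^n$ with $\Phi(\tau,y)\ge\Phi(t,x)+\alpha(\tau-t)+\langle\xi,y-x\rangle-\sigma(|\tau-t|^2+|y-x|^2)$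 for all $(\tau,y)\in U$. Let $\Phi:[0,\infty)\times\mathbb R^n\to\mathbb R$ be continuous. With $\sup\emptyset=-\infty$ and $\inf\emptyset=+\infty$, the following hold. (a) Let $J=[0,\infty)$ or $J=(0,\infty)$. Then $$\sup_{(\alpha,\xi)\in\partial_P\Phi(s,z)}\{\alpha+\mathcal H(s,z,\xi)\}\le0\ \ \forall (s,z)\in J\times\mathbb R^n \iff \sup_{(\alpha,\xi)\in\partial_D\Phi(s,z)}\{\alpha+\mathcal H(s,z,\xi)\}\le0\ \ \forall (s,z)\in J\times\mathbb R^n.$$ (b) Let $J=[0,\infty)$ or $J=(0,\infty)$. Then $$\inf_{(\alpha,\xi)\in\partial_P\Phi(s,z)}\{\alpha+\mathcal H(s,z,\xi)\}\ge0\ \ \forall (s,z)\in (0,\infty)\times\mathbb R^n \iff \inf_{(\alpha,\xi)\in\partial^D\Phi(s,z)}\{\alpha+\mathcal H(s,z,\xi)\}\ge0\ \ \forall (s,z)\in J\times\mathbb R^n.$$ -/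

import Mathlib

open Set Filter Topology

noncomputable section

/-- The pre-Hamiltonian `H(t,x,ξ,u) = ⟨ξ, f(t,x,u)⟩ + e^{-δt} l(t,x,u)`. -/
def preHamiltonian {n m : ℕ} (δ : ℝ)
    (l : ℝ → EuclideanSpace ℝ (Fin n) → EuclideanSpace ℝ (Fin m) → ℝ)
    (f : ℝ → EuclideanSpace ℝ (Fin n) → EuclideanSpace ℝ (Fin m) → EuclideanSpace ℝ (Fin n))
    (t : ℝ) (x ξ : EuclideanSpace ℝ (Fin n)) (u : EuclideanSpace ℝ (Fin m)) : ℝ :=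
  inner ℝ ξ (f t x u) + Real.exp (-δ * t) * l t x u

/-- The Hamiltonian `𝓗(t,x,ξ) = inf_{u ∈ Ω} H(t,x,ξ,u)`. The infimum is over a nonempty set that is
bounded below whenever `Ω` is nonempty and compact and `f`, `l` are continuous. -/
def hamiltonian {n m : ℕ} (δ : ℝ)
    (l : ℝ → EuclideanSpace ℝ (Fin n) → EuclideanSpace ℝ (Fin m) → ℝ)
    (f : ℝ → EuclideanSpace ℝ (Fin n) → EuclideanSpace ℝ (Fin m) → EuclideanSpace ℝ (Fin n))
    (Ω : Set (EuclideanSpace ℝ (Fin m)))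
    (t : ℝ) (x ξ : EuclideanSpace ℝ (Fin n)) : ℝ :=
  sInf ((fun u => preHamiltonian δ l f t x ξ u) '' Ω)

/-- The filter `r ↓ 0, w → ξ`, restricted to those `r` for which `t + r α` is an admissible time,
i.e. `0 ≤ t + r α`. The restriction matters only if `t = 0` and `α < 0`; then no difference quotient
is defined and the filter is trivial. -/
def diniFilter {n : ℕ} (t α : ℝ) (ξ : EuclideanSpace ℝ (Fin n)) :
    Filter (ℝ × EuclideanSpace ℝ (Fin n)) :=
  (𝓝[>] (0 : ℝ) ×ˢ 𝓝 ξ) ⊓ 𝓟 {q | 0 ≤ t + q.1 * α}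

/-- Lower Dini derivative of `Φ : [0,∞) × ℝⁿ → ℝ` at `(t,x)` in the direction `(α,ξ)`, with values
in the extended reals (`+∞` in directions that leave the time domain at once). -/
def lowerDini {n : ℕ} (Φ : ℝ → EuclideanSpace ℝ (Fin n) → ℝ)
    (t : ℝ) (x : EuclideanSpace ℝ (Fin n)) (α : ℝ) (ξ : EuclideanSpace ℝ (Fin n)) : EReal :=
  liminf (fun q : ℝ × EuclideanSpace ℝ (Fin n) =>
    (((Φ (t + q.1 * α) (x + q.1 • q.2) - Φ t x) / q.1 : ℝ) : EReal)) (diniFilter t α ξ)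

/-- Upper Dini derivative of `Φ : [0,∞) × ℝⁿ → ℝ` at `(t,x)` in the direction `(α,ξ)`, with values
in the extended reals (`-∞` in directions that leave the time domain at once). -/
def upperDini {n : ℕ} (Φ : ℝ → EuclideanSpace ℝ (Fin n) → ℝ)
    (t : ℝ) (x : EuclideanSpace ℝ (Fin n)) (α : ℝ) (ξ : EuclideanSpace ℝ (Fin n)) : EReal :=
  limsup (fun q : ℝ × EuclideanSpace ℝ (Fin n) =>
    (((Φ (t + q.1 * α) (x + q.1 • q.2) - Φ t x) / q.1 : ℝ) : EReal)) (diniFilter t α ξ)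

/-- The Dini sub-gradient `∂_D Φ(t,x)`. -/
def diniSubgrad {n : ℕ} (Φ : ℝ → EuclideanSpace ℝ (Fin n) → ℝ)
    (t : ℝ) (x : EuclideanSpace ℝ (Fin n)) : Set (ℝ × EuclideanSpace ℝ (Fin n)) :=
  {p | ∀ (u : ℝ) (v : EuclideanSpace ℝ (Fin n)),
    ((u * p.1 + inner ℝ v p.2 : ℝ) : EReal) ≤ lowerDini Φ t x u v}

/-- The Dini super-gradient `∂^D Φ(t,x)`. -/
def diniSupergrad {n : ℕ} (Φ : ℝ → EuclideanSpace ℝ (Fin n) → ℝ)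
    (t : ℝ) (x : EuclideanSpace ℝ (Fin n)) : Set (ℝ × EuclideanSpace ℝ (Fin n)) :=
  {p | ∀ (u : ℝ) (v : EuclideanSpace ℝ (Fin n)),
    upperDini Φ t x u v ≤ ((u * p.1 + inner ℝ v p.2 : ℝ) : EReal)}

/-- The proximal sub-gradient `∂_P Φ(t,x)`; neighbourhoods are taken in `[0,∞) × ℝⁿ`. -/
def proxSubgrad {n : ℕ} (Φ : ℝ → EuclideanSpace ℝ (Fin n) → ℝ)
    (t : ℝ) (x : EuclideanSpace ℝ (Fin n)) : Set (ℝ × EuclideanSpace ℝ (Fin n)) :=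
  {p | ∃ σ : ℝ, 0 < σ ∧ ∃ U ∈ 𝓝[Ici (0 : ℝ) ×ˢ univ] (t, x), ∀ q ∈ U,
    Φ q.1 q.2 ≥ Φ t x + p.1 * (q.1 - t) + inner ℝ p.2 (q.2 - x)
      - σ * (‖q.1 - t‖ ^ 2 + ‖q.2 - x‖ ^ 2)}

end

/-! One half of (a) is the inclusion of proximal in Dini sub-gradients. The other implications pass
between kinds of gradient that need not exist at the same points, so the inequality is carried over
from nearby points, found by minimising penalised functions.

For the converse in (a), suppose a Dini sub-gradient has `α + 𝓗 > 0`. After subtraction of a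
slightly tilted affine function, `Φ` is nonnegative on the end section of a short cone whose
velocities lie near the compact convex set `f t x '' Ω`. The multidirectional mean value inequality
`exists_proxSubgrad_of_nonneg_on_cone` yields one nearby proximal sub-gradient that is almost
nonnegative on all these velocities at once. This uniformity, which convexity provides, is
essential: the control that nearly attains the Hamiltonian is known only after the sub-gradient.

In (b) a lower bound on `𝓗` is a bound for each control separately, so trajectories of constant
controls suffice. `sub_mul_le_of_proxSubgrad_along_trajectory` integrates the proximal inequality to
a lower bound for `Φ` forward along a trajectory; differentiation at its start gives the Dini
inequality. Only later times enter, so `t = 0` is covered. Conversely, the same lemma is applied to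
the time reversal of `-Φ`, whose proximal sub-gradients give Dini super-gradients of `Φ`. It bounds
`Φ` above backward along the trajectory, against the lower bound that a proximal sub-gradient
supplies. -/

/-! ### Quadratic expansions and a variational inequality -/

/-- Second order upper expansion of the squared positive part. -/
theorem sq_max_zero_le (a b : ℝ) :
    max 0 b ^ 2 ≤ max 0 a ^ 2 + 2 * max 0 a * (b - a) + (b - a) ^ 2 := by
  rcases le_total 0 a with ha | ha <;> rcases le_total 0 b with hb | hb <;>
    simp only [max_eq_left, max_eq_right, ha, hb] <;> nlinarith

/-- Second order expansion of a squared norm along an increment `d - h • c`. -/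
theorem norm_add_sub_smul_sq_le {E : Type*} [NormedAddCommGroup E] [InnerProductSpace ℝ E]
    (e d c : E) (h : ℝ) :
    ‖e + (d - h • c)‖ ^ 2 ≤ ‖e‖ ^ 2 + 2 * inner ℝ e d - 2 * h * inner ℝ e c
      + (2 * ‖d‖ ^ 2 + 2 * ‖c‖ ^ 2 * h ^ 2) := by
  have h1 : ‖d - h • c‖ ^ 2 ≤ 2 * ‖d‖ ^ 2 + 2 * ‖c‖ ^ 2 * h ^ 2 := by
    have := norm_sub_le d (h • c)
    rw [norm_smul, Real.norm_eq_abs] at this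
    have h2 : (|h| * ‖c‖) ^ 2 = ‖c‖ ^ 2 * h ^ 2 := by rw [mul_pow, sq_abs]; ring
    nlinarith [norm_nonneg (d - h • c), norm_nonneg d, sq_nonneg (‖d‖ - |h| * ‖c‖),
      mul_nonneg (abs_nonneg h) (norm_nonneg c)]
  rw [norm_add_sq_real, inner_sub_right, inner_smul_right]
  linarith

/-- If `c` minimizes `‖b - θ • c‖` over a convex set, then the residual `b - θ • c` supports
the set at `c`. -/
theorem inner_le_of_norm_sub_smul_min {E : Type*} [NormedAddCommGroup E] [InnerProductSpace ℝ E]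
    {C : Set E} (hC : Convex ℝ C) {b c v : E} {θ : ℝ} (hθ : 0 < θ) (hc : c ∈ C) (hv : v ∈ C)
    (hmin : ∀ w ∈ C, ‖b - θ • c‖ ^ 2 ≤ ‖b - θ • w‖ ^ 2) :
    inner ℝ (b - θ • c) v ≤ inner ℝ (b - θ • c) c := by
  by_contra! hlt
  set e := b - θ • c with he
  set γ := inner ℝ e v - inner ℝ e c with hγ
  have hγ0 : 0 < γ := by rw [hγ]; linarith
  set N := θ * ‖v - c‖ ^ 2 with hN
  have hN0 : 0 ≤ N := by positivity
  -- A step this short makes the first-order gain `2θμγ` exceed the second-order loss `θμ · μN`.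
  set μ := γ / (γ + N) with hμ
  have hμ0 : 0 < μ := by positivity
  have hμ1 : μ ≤ 1 := by rw [hμ, div_le_one (by positivity)]; linarith
  have hμN : μ * N < γ * 1 := by
    have : μ * (γ + N) = γ := by rw [hμ]; field_simp
    nlinarith
  have hw : c + μ • (v - c) ∈ C := hC.add_smul_sub_mem hc hv ⟨hμ0.le, hμ1⟩
  have h1 := hmin _ hw
  have h2 : b - θ • (c + μ • (v - c)) = e - (θ * μ) • (v - c) := by
    rw [he, smul_add, mul_smul]; abel
  rw [h2, norm_sub_sq_real e, inner_smul_right, norm_smul, mul_pow, inner_sub_right, ← hγ,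
    Real.norm_eq_abs, sq_abs] at h1
  have h3 : (θ * μ) ^ 2 * ‖v - c‖ ^ 2 = θ * μ * (μ * N) := by rw [hN]; ring
  rw [h3] at h1
  have : 0 < θ * μ := by positivity
  nlinarith

/-! ### Multidirectional mean value inequality -/

set_option maxHeartbeats 1000000 in
/-- A continuous function that vanishes at the apex and is nonnegative on the end section of a cone
with a thickened convex set of velocities has, near the apex, proximal subgradients that are almost
nonnegative on all those velocities. -/
theorem exists_proxSubgrad_of_nonneg_on_cone {n : ℕ} {G : ℝ → EuclideanSpace ℝ (Fin n) → ℝ}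
    (hG : ContinuousOn (fun p : ℝ × EuclideanSpace ℝ (Fin n) => G p.1 p.2) (Ici (0 : ℝ) ×ˢ univ))
    {t : ℝ} (ht : 0 ≤ t) {x : EuclideanSpace ℝ (Fin n)} (hG0 : G t x = 0)
    {C : Set (EuclideanSpace ℝ (Fin n))} (hCc : IsCompact C) (hCv : Convex ℝ C)
    (hCn : C.Nonempty) {m : ℝ} (hm : ∀ c ∈ C, ‖c‖ ≤ m) {η r R κ : ℝ} (hη : 0 < η) (hr : 0 < r)
    (hR : 0 < R) (hκ : 0 < κ) (hrm : 4 * r * m < R)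
    (hcone : ∀ w, ∀ c ∈ C, ‖w - c‖ ≤ η → 0 ≤ G (t + r) (x + r • w)) :
    ∃ (s : ℝ) (y : EuclideanSpace ℝ (Fin n)) (a : ℝ) (p : EuclideanSpace ℝ (Fin n)),
      0 ≤ s ∧ (0 < t → 0 < s) ∧ |s - t| ≤ r ∧ ‖y - x‖ ≤ R ∧ (a, p) ∈ proxSubgrad G s y ∧
        ∀ c ∈ C, -κ ≤ a + inner ℝ p c := by
  obtain ⟨c0, hc0⟩ := hCn
  have hm0 : 0 ≤ m := (norm_nonneg c0).trans (hm c0 hc0)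
  -- The apex is moved back by time `ρ` along `c0`. This keeps the factor `s - (t - ρ)` of the
  -- velocity positive at the minimiser; with apex time `t`, a minimum at `s = t` would say nothing
  -- about `c`.
  obtain ⟨ρ, hρ0, hρr, hρη, hρt⟩ : ∃ ρ : ℝ, 0 < ρ ∧ ρ ≤ r ∧ ρ * (2 * m) ≤ r * η / 2 ∧
      (0 < t → ρ < t) := by
    set q := r * η / 2 / (2 * m + 1) with hq
    have hq0 : 0 < q := by positivity
    have hqe : q * (2 * m + 1) = r * η / 2 := by rw [hq]; field_simp
    have hfin : ∀ ρ ≤ q, 0 < ρ → ρ * (2 * m) ≤ r * η / 2 := by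
      intro ρ h1 h2
      nlinarith
    by_cases ht0 : 0 < t
    · refine ⟨min (min r q) (t / 2), by positivity, (min_le_left _ _).trans (min_le_left _ _),
        hfin _ ((min_le_left _ _).trans (min_le_right _ _)) (by positivity), fun _ => ?_⟩
      exact (min_le_right _ _).trans_lt (by linarith)
    · exact ⟨min r q, by positivity, min_le_left _ _, hfin _ (min_le_right _ _) (by positivity),
        fun h => absurd h ht0⟩
  set x0 := x - ρ • c0 with hx0
  set I := Icc (max 0 (t - ρ)) (t + r) with hI
  have hIt : ∀ s ∈ I, 0 ≤ s ∧ t - ρ ≤ s ∧ s ≤ t + r := fun s hs =>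
    ⟨(le_max_left _ _).trans hs.1, (le_max_right _ _).trans hs.1, hs.2⟩
  have hcompB : IsCompact (I ×ˢ Metric.closedBall x R) :=
    isCompact_Icc.prod (isCompact_closedBall _ _)
  have hGcont : ContinuousOn (fun p : ℝ × EuclideanSpace ℝ (Fin n) => G p.1 p.2 + κ * (p.1 - t))
      (I ×ˢ Metric.closedBall x R) :=
    (hG.mono fun p hp => ⟨(hIt _ hp.1).1, trivial⟩).add (by fun_prop)
  obtain ⟨B, hB⟩ := hcompB.exists_bound_of_continuousOn hGcont
  set B0 := |B| + 1 with hB0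
  have hB0p : 0 < B0 := by positivity
  have hBlow : ∀ s ∈ I, ∀ y ∈ Metric.closedBall x R, -B0 < G s y + κ * (s - t) := by
    intro s hs y hy
    have := hB (s, y) ⟨hs, hy⟩
    rw [Real.norm_eq_abs] at this
    have h2 := neg_abs_le (G s y + κ * (s - t))
    simp only at this
    linarith [le_abs_self B]
  -- Each summand excludes one part of the boundary: points of the end section farther than `r * η /
  -- 2` from the ray, and the sphere `‖y - x‖ = R`, where the distance to the ray is at least `R /
  -- 4`.
  set k := B0 / (r * η / 2) ^ 2 + B0 / (R / 4) ^ 2 with hk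
  have hk0 : 0 < k := by positivity
  have hk1 : B0 ≤ k * (r * η / 2) ^ 2 := by
    rw [hk, add_mul, div_mul_cancel₀ _ (by positivity)]
    have : 0 ≤ B0 / (R / 4) ^ 2 * (r * η / 2) ^ 2 := by positivity
    linarith
  have hk2 : B0 ≤ k * (R / 4) ^ 2 := by
    rw [hk, add_mul, div_mul_cancel₀ _ (by positivity)]
    have : 0 ≤ B0 / (r * η / 2) ^ 2 * (R / 4) ^ 2 := by positivity
    linarith
  set M := B0 / ρ ^ 2 with hM
  have hM0 : 0 < M := by positivity
  have hMρ : M * ρ ^ 2 = B0 := by rw [hM]; field_simp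
  -- `W` vanishes at `(t, x, c0)`, which lies on a ray from the shifted apex. The tilt `κ` makes `W`
  -- positive where the end section meets the thickened cone, and the `M` term makes it positive at
  -- `s = t - ρ`. The velocity `c` is minimised as well.
  let W : ℝ × EuclideanSpace ℝ (Fin n) × EuclideanSpace ℝ (Fin n) → ℝ := fun q =>
    G q.1 q.2.1 + κ * (q.1 - t) + k * ‖q.2.1 - x0 - (q.1 - (t - ρ)) • q.2.2‖ ^ 2
      + M * max 0 (t - q.1) ^ 2
  have hWc : ContinuousOn W (I ×ˢ Metric.closedBall x R ×ˢ C) := by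
    refine ((hGcont.comp (f := fun q : ℝ × EuclideanSpace ℝ (Fin n) × EuclideanSpace ℝ (Fin n) =>
      (q.1, q.2.1)) (by fun_prop) fun q hq => ⟨hq.1, hq.2.1⟩).add ?_).add ?_
    · fun_prop
    · fun_prop
  have htI : t ∈ I := ⟨max_le ht (by linarith), by linarith⟩
  have hmem : (t, x, c0) ∈ I ×ˢ Metric.closedBall x R ×ˢ C :=
    ⟨htI, Metric.mem_closedBall_self hR.le, hc0⟩
  obtain ⟨⟨s, y, c⟩, ⟨hs, hy, hc⟩, hmin⟩ :=
    (isCompact_Icc.prod ((isCompact_closedBall _ _).prod hCc)).exists_isMinOn ⟨_, hmem⟩ hWc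
  simp only at hs hy hc
  have hmin' : ∀ s' ∈ I, ∀ y' ∈ Metric.closedBall x R, ∀ c' ∈ C, W (s, y, c) ≤ W (s', y', c') :=
    fun s' h1 y' h2 c' h3 => hmin (show (s', y', c') ∈ _ from ⟨h1, h2, h3⟩)
  have hW0 : W (s, y, c) ≤ 0 := by
    refine (hmin' t htI x (Metric.mem_closedBall_self hR.le) c0 hc0).trans (le_of_eq ?_)
    simp [W, hG0, hx0]
  obtain ⟨hs0, hs1, hs2⟩ := hIt s hs
  set e := y - x0 - (s - (t - ρ)) • c with he
  have hW0' : G s y + κ * (s - t) + k * ‖e‖ ^ 2 + M * max 0 (t - s) ^ 2 ≤ 0 := hW0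
  have hlow := hBlow s hs y hy
  have hke : 0 ≤ k * ‖e‖ ^ 2 := by positivity
  have hMe : 0 ≤ M * max 0 (t - s) ^ 2 := by positivity
  have hs1' : t - ρ < s := by
    rcases hs1.lt_or_eq with h | h
    · exact h
    · exfalso
      rw [← h, show t - (t - ρ) = ρ by ring, max_eq_right hρ0.le, hMρ] at hW0'
      rw [← h] at hlow
      linarith
  have hecomp : y - x = e + (s - (t - ρ)) • c - ρ • c0 := by
    rw [he, hx0]; abel
  have hs2' : s < t + r := by
    rcases hs2.lt_or_eq with h | h
    · exact h
    · exfalso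
      subst h
      by_cases hle : ‖e‖ ≤ r * η / 2
      · set w := r⁻¹ • (y - x) with hw
        have hyw : y = x + r • w := by
          rw [hw, smul_inv_smul₀ hr.ne']; abel
        have hwc : w - c = r⁻¹ • (e + ρ • (c - c0)) := by
          have : c = r⁻¹ • (r • c) := by rw [inv_smul_smul₀ hr.ne']
          rw [hw]
          conv_lhs => rw [this]
          rw [← smul_sub, hecomp]
          congr 1
          module
        have hcc : ‖c - c0‖ ≤ 2 * m := (norm_sub_le _ _).trans (by linarith [hm c hc, hm c0 hc0])
        have hwη : ‖w - c‖ ≤ η := by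
          rw [hwc, norm_smul, norm_inv, Real.norm_of_nonneg hr.le, inv_mul_le_iff₀ hr]
          refine (norm_add_le _ _).trans ?_
          rw [norm_smul, Real.norm_of_nonneg hρ0.le]
          nlinarith
        have := hcone w c hc hwη
        rw [← hyw] at this
        have : 0 < κ * (t + r - t) := by rw [add_sub_cancel_left]; positivity
        linarith
      · push Not at hle
        have : (r * η / 2) ^ 2 < ‖e‖ ^ 2 := by
          have h0 : 0 ≤ r * η / 2 := by positivity
          gcongr
        have := mul_lt_mul_of_pos_left this hk0
        linarith
  have hyx : ‖y - x‖ ≤ R := by simpa [dist_eq_norm] using hy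
  have hyR : ‖y - x‖ < R := by
    rcases hyx.lt_or_eq with h | h
    · exact h
    · exfalso
      have h1 : ‖y - x‖ ≤ ‖e‖ + (s - (t - ρ)) * m + ρ * m := by
        rw [hecomp]
        refine (norm_sub_le _ _).trans (add_le_add ((norm_add_le _ _).trans (add_le_add le_rfl ?_)) ?_)
        · rw [norm_smul, Real.norm_of_nonneg (by linarith)]
          exact mul_le_mul_of_nonneg_left (hm c hc) (by linarith)
        · rw [norm_smul, Real.norm_of_nonneg hρ0.le]
          exact mul_le_mul_of_nonneg_left (hm c0 hc0) hρ0.le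
      have h2 : R / 4 ≤ ‖e‖ := by
        have : (s - (t - ρ)) * m ≤ 2 * r * m := mul_le_mul_of_nonneg_right (by linarith) hm0
        have : ρ * m ≤ r * m := mul_le_mul_of_nonneg_right hρr hm0
        linarith
      have : (R / 4) ^ 2 ≤ ‖e‖ ^ 2 := by gcongr
      have := mul_le_mul_of_nonneg_left this hk0.le
      linarith
  -- The negative of the gradient in `(s, y)`, at fixed `c`, of everything added to `G`.
  refine ⟨s, y, -κ + 2 * k * inner ℝ e c + 2 * M * max 0 (t - s), -(2 * k) • e, hs0,
    fun h => ?_, ?_, hyR.le, ?_, ?_⟩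
  · linarith [hρt h]
  · rw [abs_le]; constructor <;> linarith
  · refine ⟨2 * k + 2 * k * ‖c‖ ^ 2 + M, by positivity,
      (Ioo (t - ρ) (t + r) ×ˢ Metric.ball x R) ∩ (Ici 0 ×ˢ univ), ?_, ?_⟩
    · refine inter_mem (mem_nhdsWithin_of_mem_nhds ?_) self_mem_nhdsWithin
      exact prod_mem_nhds (Ioo_mem_nhds hs1' hs2') (Metric.isOpen_ball.mem_nhds
        (by simpa [dist_eq_norm] using hyR))
    · rintro ⟨s', y'⟩ ⟨⟨h1, h2⟩, h3, -⟩
      simp only at h1 h2 h3 ⊢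
      have h4 : W (s, y, c) ≤ W (s', y', c) :=
        hmin' s' ⟨max_le h3 h1.1.le, h1.2.le⟩ y' (Metric.ball_subset_closedBall h2) c hc
      simp only [W] at h4
      rw [← he] at h4
      have h5 : y' - x0 - (s' - (t - ρ)) • c = e + ((y' - y) - (s' - s) • c) := by
        rw [he]; module
      rw [h5] at h4
      have h6 := norm_add_sub_smul_sq_le e (y' - y) c (s' - s)
      have h7 := sq_max_zero_le (t - s) (t - s')
      have h6' := mul_le_mul_of_nonneg_left h6 hk0.le
      have h7' := mul_le_mul_of_nonneg_left h7 hM0.le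
      rw [inner_smul_left, Real.norm_eq_abs, sq_abs]
      simp only [map_neg, conj_trivial]
      have h8 : 0 ≤ M * ‖y' - y‖ ^ 2 := by positivity
      have h9 : 0 ≤ k * ‖c‖ ^ 2 * ‖y' - y‖ ^ 2 := by positivity
      have h10 : 0 ≤ k * (s' - s) ^ 2 := by positivity
      nlinarith
  · intro v hv
    -- Minimality in `c` makes `e` support `C` at `c`, so one `p = -2ke` serves all velocities `v`.
    have hvar : inner ℝ e v ≤ inner ℝ e c := by
      refine inner_le_of_norm_sub_smul_min hCv (b := y - x0) (by linarith) hc hv fun w hw => ?_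
      have := hmin' s hs y hy w hw
      simp only [W] at this
      have h' : k * ‖y - x0 - (s - (t - ρ)) • c‖ ^ 2 ≤ k * ‖y - x0 - (s - (t - ρ)) • w‖ ^ 2 := by
        linarith
      exact le_of_mul_le_mul_left h' hk0
    rw [inner_smul_left]
    simp only [map_neg, conj_trivial]
    have : 0 ≤ M * max 0 (t - s) := by positivity
    nlinarith

/-! ### Monotonicity along trajectories -/

set_option maxHeartbeats 1000000 in
/-- Monotonicity along a trajectory `X` of the Lipschitz field `F`: if every proximal subgradient
`(a, p)` of `Φ` near `X` satisfies `-c ≤ a + ⟪p, F⟫`, then `Φ` decreases along `X` with rate at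
most `c`. -/
theorem sub_mul_le_of_proxSubgrad_along_trajectory {n : ℕ}
    {Φ : ℝ → EuclideanSpace ℝ (Fin n) → ℝ} {T₀ T₁ : ℝ} (h01 : T₀ < T₁)
    (hΦ : ContinuousOn (fun p : ℝ × EuclideanSpace ℝ (Fin n) => Φ p.1 p.2)
      (Icc T₀ T₁ ×ˢ univ))
    {F : ℝ → EuclideanSpace ℝ (Fin n) → EuclideanSpace ℝ (Fin n)}
    (hF : ContinuousOn (fun p : ℝ × EuclideanSpace ℝ (Fin n) => F p.1 p.2) (Icc T₀ T₁ ×ˢ univ))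
    {K : ℝ} (hK : 0 ≤ K) (hFK : ∀ s ∈ Icc T₀ T₁, ∀ y z, ‖F s y - F s z‖ ≤ K * ‖y - z‖)
    {X : ℝ → EuclideanSpace ℝ (Fin n)} (hX : ContinuousOn X (Icc T₀ T₁))
    (hXd : ∀ s ∈ Ioo T₀ T₁, HasDerivAt X (F s (X s)) s)
    {V : Set (EuclideanSpace ℝ (Fin n))} {R : ℝ} (hR : 0 < R)
    (hV : ∀ s ∈ Icc T₀ T₁, ∀ z, ‖z‖ ≤ R → X s + z ∈ V) {c : ℝ}
    (hprox : ∀ s ∈ Ioo T₀ T₁, ∀ y ∈ V, ∀ a p, (a, p) ∈ proxSubgrad Φ s y →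
      -c ≤ a + inner ℝ p (F s y)) :
    Φ T₀ (X T₀) - c * (T₁ - T₀) ≤ Φ T₁ (X T₁) := by
  by_contra! hlt
  have hΔ : 0 < T₁ - T₀ := by linarith
  obtain ⟨ε, hε, hεgap⟩ : ∃ ε : ℝ, 0 < ε ∧
      Φ T₁ (X T₁) + (c + ε) * (T₁ - T₀) < Φ T₀ (X T₀) := by
    refine ⟨(Φ T₀ (X T₀) - c * (T₁ - T₀) - Φ T₁ (X T₁)) / (2 * (T₁ - T₀)), by
      apply div_pos <;> linarith, ?_⟩
    have : (Φ T₀ (X T₀) - c * (T₁ - T₀) - Φ T₁ (X T₁)) / (2 * (T₁ - T₀)) * (T₁ - T₀)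
        = (Φ T₀ (X T₀) - c * (T₁ - T₀) - Φ T₁ (X T₁)) / 2 := by field_simp
    rw [add_mul, this]; linarith
  obtain ⟨γ, hγ1, hγ0⟩ := exists_between hεgap
  -- Time is doubled: `X` is differentiable but its derivative need not be Lipschitz, so a penalty
  -- `‖y - X s‖ ^ 2` would lack the quadratic bound in `s` that a proximal sub-gradient needs. With
  -- `X` evaluated at `τ`, the penalties are quadratic in `(s, y)`.
  let h : ℝ × ℝ × EuclideanSpace ℝ (Fin n) → ℝ := fun q =>
    Φ q.1 (X q.2.1 + q.2.2) + (c + ε) * (q.1 - T₀)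
  have hXq : ContinuousOn (fun q : ℝ × ℝ × EuclideanSpace ℝ (Fin n) => X q.2.1 + q.2.2)
      (Icc T₀ T₁ ×ˢ Icc T₀ T₁ ×ˢ univ) :=
    (hX.comp (by fun_prop) fun q hq => hq.2.1).add (by fun_prop)
  have hhc : ContinuousOn h (Icc T₀ T₁ ×ˢ Icc T₀ T₁ ×ˢ univ) :=
    (hΦ.comp (f := fun q : ℝ × ℝ × EuclideanSpace ℝ (Fin n) => (q.1, X q.2.1 + q.2.2))
      (continuousOn_fst.prodMk hXq) fun q hq => ⟨hq.1, trivial⟩).add (by fun_prop)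
  have hT0 : T₀ ∈ Icc T₀ T₁ := left_mem_Icc.2 h01.le
  have hT1 : T₁ ∈ Icc T₀ T₁ := right_mem_Icc.2 h01.le
  obtain ⟨T', hT', hT'γ⟩ : ∃ T' ∈ Ioo T₀ T₁, h (T', T', 0) < γ := by
    have hdiag : ContinuousOn (fun s => h (s, s, 0)) (Icc T₀ T₁) :=
      hhc.comp (f := fun s : ℝ => ((s, s, 0) : ℝ × ℝ × EuclideanSpace ℝ (Fin n)))
        (by fun_prop) fun s hs => ⟨hs, hs, trivial⟩
    have h1 : ∀ᶠ s in 𝓝[Ioo T₀ T₁] T₁, h (s, s, 0) < γ := by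
      have := (hdiag T₁ hT1).mono (Ioo_subset_Icc_self)
      exact this.eventually_lt_const (by simpa [h] using hγ1)
    have : (𝓝[Ioo T₀ T₁] T₁).NeBot := by
      rw [← mem_closure_iff_nhdsWithin_neBot, closure_Ioo h01.ne]; exact hT1
    obtain ⟨s, hs1, hs2⟩ := (h1.and self_mem_nhdsWithin).exists
    exact ⟨s, hs2, hs1⟩
  have hT'I : T' ∈ Icc T₀ T₁ := Ioo_subset_Icc_self hT'
  obtain ⟨θ₀, hθ₀, hθ₀γ⟩ : ∃ θ₀ > 0, ∀ s ∈ Icc T₀ T₁, ∀ τ ∈ Icc T₀ T₁, ∀ z, s - T₀ < θ₀ →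
      τ - T₀ < θ₀ → ‖z‖ < θ₀ → γ < h (s, τ, z) := by
    have h1 : ∀ᶠ q in 𝓝[Icc T₀ T₁ ×ˢ Icc T₀ T₁ ×ˢ univ]
        ((T₀, T₀, 0) : ℝ × ℝ × EuclideanSpace ℝ (Fin n)), γ < h q :=
      (hhc (T₀, T₀, 0) ⟨hT0, hT0, trivial⟩).eventually_const_lt (by simpa [h] using hγ0)
    obtain ⟨θ₀, hθ₀, hb⟩ := Metric.mem_nhdsWithin_iff.1 h1
    refine ⟨θ₀, hθ₀, fun s hs τ hτ z h2 h3 h4 => hb ⟨?_, hs, hτ, trivial⟩⟩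
    rw [Metric.mem_ball, Prod.dist_eq, Prod.dist_eq, Real.dist_eq, Real.dist_eq, dist_zero_right,
      abs_of_nonneg (by linarith [hs.1]), abs_of_nonneg (by linarith [hτ.1])]
    exact max_lt h2 (max_lt h3 h4)
  have hcomp : IsCompact (Icc T₀ T₁ ×ˢ Icc T₀ T₁ ×ˢ
      Metric.closedBall (0 : EuclideanSpace ℝ (Fin n)) R) :=
    isCompact_Icc.prod (isCompact_Icc.prod (isCompact_closedBall _ _))
  have hhc' : ContinuousOn h (Icc T₀ T₁ ×ˢ Icc T₀ T₁ ×ˢ Metric.closedBall 0 R) :=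
    hhc.mono (by gcongr; exact subset_univ _)
  obtain ⟨θ, hθ, hθh⟩ : ∃ θ > 0, ∀ s ∈ Icc T₀ T₁, ∀ τ ∈ Icc T₀ T₁, ∀ z, ‖z‖ ≤ R → ‖z‖ < θ →
      h (s, τ, 0) - h (s, τ, z) < ε / (8 * (K + 1)) := by
    obtain ⟨θ, hθ, hb⟩ := Metric.uniformContinuousOn_iff.1
      (hcomp.uniformContinuousOn_of_continuous hhc') (ε / (8 * (K + 1))) (by positivity)
    refine ⟨θ, hθ, fun s hs τ hτ z hz hzθ => ?_⟩
    have := hb (s, τ, 0) ⟨hs, hτ, Metric.mem_closedBall_self hR.le⟩ (s, τ, z)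
      ⟨hs, hτ, by simpa using hz⟩ (by simp [Prod.dist_eq, hzθ])
    rw [Real.dist_eq] at this
    exact (le_abs_self _).trans_lt this
  obtain ⟨B, hB⟩ := hcomp.exists_bound_of_continuousOn hhc'
  set B0 := |B| + 1 with hB0
  have hB0p : 0 < B0 := by positivity
  have hBabs : ∀ s ∈ Icc T₀ T₁, ∀ τ ∈ Icc T₀ T₁, ∀ z, ‖z‖ ≤ R → |h (s, τ, z)| < B0 := by
    intro s hs τ hτ z hz
    have := hB (s, τ, z) ⟨hs, hτ, by simpa using hz⟩
    rw [Real.norm_eq_abs] at this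
    linarith [le_abs_self B]
  obtain ⟨ζ, hζ, hζ0, hζθ, hζR⟩ : ∃ ζ : ℝ, 0 < ζ ∧ ζ ≤ θ₀ ∧ ζ ≤ θ ∧ ζ ≤ R :=
    ⟨min θ₀ (min θ R), by positivity, min_le_left _ _, (min_le_right _ _).trans (min_le_left _ _),
      (min_le_right _ _).trans (min_le_right _ _)⟩
  -- Two values of `h` differ by less than `2 * B0`, so no penalty reaches that value at the
  -- minimiser. The order of choice matters: `θ₂` depends on `k`, and `j` on `θ₂`.
  obtain ⟨k, hk, hkζ⟩ : ∃ k : ℝ, 0 < k ∧ k * ζ ^ 2 = 2 * B0 :=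
    ⟨2 * B0 / ζ ^ 2, by positivity, by field_simp⟩
  obtain ⟨θ₂, hθ₂, hθ₂F⟩ : ∃ θ₂ > 0, ∀ s ∈ Icc T₀ T₁, ∀ τ ∈ Icc T₀ T₁, |s - τ| < θ₂ →
      ‖F τ (X τ) - F s (X τ)‖ < ε / (8 * k * R) := by
    have hFX : ContinuousOn (fun q : ℝ × ℝ => F q.1 (X q.2)) (Icc T₀ T₁ ×ˢ Icc T₀ T₁) :=
      hF.comp (f := fun q : ℝ × ℝ => (q.1, X q.2))
        (continuousOn_fst.prodMk (hX.comp continuousOn_snd fun q hq => hq.2))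
        fun q hq => ⟨hq.1, trivial⟩
    obtain ⟨θ₂, hθ₂, hb⟩ := Metric.uniformContinuousOn_iff.1
      ((isCompact_Icc.prod isCompact_Icc).uniformContinuousOn_of_continuous hFX)
      (ε / (8 * k * R)) (by positivity)
    refine ⟨θ₂, hθ₂, fun s hs τ hτ hst => ?_⟩
    have := hb (τ, τ) ⟨hτ, hτ⟩ (s, τ) ⟨hs, hτ⟩
      (by rw [Prod.dist_eq, Real.dist_eq, dist_self, abs_sub_comm]; exact max_lt hst hθ₂)
    rwa [dist_eq_norm] at this
  obtain ⟨ν, hν, hν0, hν2, hνT⟩ : ∃ ν : ℝ, 0 < ν ∧ ν ≤ θ₀ ∧ ν ≤ θ₂ ∧ ν ≤ (T₁ - T') / 2 := by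
    have : 0 < T₁ - T' := by linarith [hT'.2]
    exact ⟨min θ₀ (min θ₂ ((T₁ - T') / 2)), by positivity, min_le_left _ _,
      (min_le_right _ _).trans (min_le_left _ _), (min_le_right _ _).trans (min_le_right _ _)⟩
  obtain ⟨j, hj, hjν⟩ : ∃ j : ℝ, 0 < j ∧ j * ν ^ 2 = 2 * B0 :=
    ⟨2 * B0 / ν ^ 2, by positivity, by field_simp⟩
  obtain ⟨M, hM, hMT⟩ : ∃ M : ℝ, 0 < M ∧ M * ((T₁ - T') / 2) ^ 2 = 2 * B0 := by
    have : 0 < T₁ - T' := by linarith [hT'.2]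
    exact ⟨2 * B0 / ((T₁ - T') / 2) ^ 2, by positivity, by field_simp⟩
  let W : ℝ × ℝ × EuclideanSpace ℝ (Fin n) → ℝ := fun q =>
    h q + k * ‖q.2.2‖ ^ 2 + j * (q.1 - q.2.1) ^ 2 + M * max 0 (q.1 - T') ^ 2
  have hWc : ContinuousOn W (Icc T₀ T₁ ×ˢ Icc T₀ T₁ ×ˢ Metric.closedBall 0 R) :=
    ((hhc'.add (by fun_prop)).add (by fun_prop)).add (by fun_prop)
  obtain ⟨⟨s, τ, z⟩, ⟨hs, hτ, hz⟩, hmin⟩ := hcomp.exists_isMinOn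
    ⟨(T', T', 0), hT'I, hT'I, Metric.mem_closedBall_self hR.le⟩ hWc
  simp only [mem_closedBall_zero_iff] at hs hτ hz
  have hmin' : ∀ s' ∈ Icc T₀ T₁, ∀ τ' ∈ Icc T₀ T₁, ∀ z', ‖z'‖ ≤ R →
      W (s, τ, z) ≤ W (s', τ', z') :=
    fun s' h1 τ' h2 z' h3 => hmin (show (s', τ', z') ∈ _ from ⟨h1, h2, by simpa using h3⟩)
  have hWT : W (s, τ, z) ≤ h (T', T', 0) := by
    refine (hmin' T' hT'I T' hT'I 0 (by simpa using hR.le)).trans (le_of_eq ?_)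
    simp [W]
  have hWe : h (s, τ, z) + k * ‖z‖ ^ 2 + j * (s - τ) ^ 2 + M * max 0 (s - T') ^ 2
      ≤ h (T', T', 0) := hWT
  have hb1 := abs_lt.1 (hBabs s hs τ hτ z hz)
  have hb2 := abs_lt.1 (hBabs T' hT'I T' hT'I 0 (by simpa using hR.le))
  have hkz : 0 ≤ k * ‖z‖ ^ 2 := by positivity
  have hjs : 0 ≤ j * (s - τ) ^ 2 := by positivity
  have hMs : 0 ≤ M * max 0 (s - T') ^ 2 := by positivity
  have hzζ : ‖z‖ < ζ := by
    refine lt_of_pow_lt_pow_left₀ 2 hζ.le (lt_of_mul_lt_mul_left (a := k) ?_ hk.le)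
    linarith
  have hsν : |s - τ| < ν := by
    refine lt_of_pow_lt_pow_left₀ 2 hν.le (lt_of_mul_lt_mul_left (a := j) ?_ hj.le)
    rw [sq_abs]; linarith
  have hsν' := abs_lt.1 hsν
  have hsT : s - T' < (T₁ - T') / 2 := by
    have : max 0 (s - T') < (T₁ - T') / 2 := by
      refine lt_of_pow_lt_pow_left₀ 2 (by linarith [hT'.2])
        (lt_of_mul_lt_mul_left (a := M) ?_ hM.le)
      linarith
    exact (le_max_right _ _).trans_lt this
  -- The minimum is below `γ`, while `h` exceeds `γ` near the initial point; on the right, the `M`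
  -- penalty keeps the times away from `T₁`.
  have hnear : ¬ (s - T₀ < θ₀ ∧ τ - T₀ < θ₀) := fun ⟨h1, h2⟩ => by
    have := hθ₀γ s hs τ hτ z h1 h2 (hzζ.trans_le hζ0)
    linarith
  have hsI : s ∈ Ioo T₀ T₁ := by
    refine ⟨lt_of_le_of_ne hs.1 fun he => hnear ⟨?_, ?_⟩, by linarith⟩ <;> linarith
  have hτI : τ ∈ Ioo T₀ T₁ := by
    refine ⟨lt_of_le_of_ne hτ.1 fun he => hnear ⟨?_, ?_⟩, by linarith⟩ <;> linarith
  have hzR : ‖z‖ < R := hzζ.trans_le hζR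
  -- Comparison with `z = 0` bounds `k‖z‖²` by an oscillation of `h`. Mere boundedness would not
  -- control the Lipschitz error `k‖z‖ · K‖z‖`.
  have hkε : k * ‖z‖ ^ 2 * K ≤ ε / 8 := by
    have h1 := hmin' s hs τ hτ 0 (by simpa using hR.le)
    simp only [W, norm_zero] at h1
    have h2 := hθh s hs τ hτ z hz (hzζ.trans_le hζθ)
    have h3 : k * ‖z‖ ^ 2 ≤ ε / (8 * (K + 1)) := by linarith
    calc k * ‖z‖ ^ 2 * K ≤ ε / (8 * (K + 1)) * (K + 1) := by gcongr; linarith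
      _ = ε / 8 := by field_simp
  -- Vary `τ` with `y = X τ + z` fixed: `Φ` does not change, so the remaining function is
  -- differentiable. This turns the unbounded-looking `j * (s - τ)` into a term that nearly cancels
  -- against the spatial pairing.
  have hstat : j * (s - τ) = -(k * inner ℝ z (F τ (X τ))) := by
    set y := X τ + z with hy
    have hd1 : HasDerivAt (fun τ' => y - X τ') (-F τ (X τ)) τ := (hXd τ hτI).const_sub y
    have hd2 : HasDerivAt (fun τ' => k * ‖y - X τ'‖ ^ 2 + j * (s - τ') ^ 2)
        (k * (2 * inner ℝ (y - X τ) (-F τ (X τ))) + j * (2 * (s - τ) ^ (2 - 1) * -1)) τ :=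
      (hd1.norm_sq.const_mul k).add ((((hasDerivAt_id τ).const_sub s).pow 2).const_mul j)
    have hloc : IsLocalMin (fun τ' => k * ‖y - X τ'‖ ^ 2 + j * (s - τ') ^ 2) τ := by
      have hyz : y - X τ = z := by rw [hy]; abel
      have h1 : ∀ᶠ τ' in 𝓝 τ, ‖y - X τ'‖ < R :=
        hd1.continuousAt.norm.eventually_lt_const (by beta_reduce; rwa [hyz])
      filter_upwards [h1, Icc_mem_nhds hτI.1 hτI.2] with τ' h2 h3
      have h4 := hmin' s hs τ' h3 (y - X τ') h2.le
      simp only [W, h, add_sub_cancel, ← hy] at h4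
      rw [hyz]
      linarith
    have h0 := hloc.hasDerivAt_eq_zero hd2
    have hyz : y - X τ = z := by rw [hy]; abel
    rw [hyz, inner_neg_right] at h0
    norm_num at h0
    linarith
  have hsub : (-(c + ε) - 2 * j * (s - τ) - 2 * M * max 0 (s - T'), -(2 * k) • z) ∈
      proxSubgrad Φ s (X τ + z) := by
    refine ⟨k + j + M, by positivity, Ioo T₀ T₁ ×ˢ Metric.ball (X τ) R,
      mem_nhdsWithin_of_mem_nhds (prod_mem_nhds (Ioo_mem_nhds hsI.1 hsI.2)
        (Metric.isOpen_ball.mem_nhds (by simpa [dist_eq_norm] using hzR))), ?_⟩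
    rintro ⟨s', y'⟩ ⟨h1, h2⟩
    simp only [Metric.mem_ball, dist_eq_norm] at h1 h2 ⊢
    have h4 := hmin' s' (Ioo_subset_Icc_self h1) τ hτ (y' - X τ) h2.le
    simp only [W, h, add_sub_cancel] at h4
    have h5 : y' - X τ = z + (y' - (X τ + z)) := by abel
    have h6 : ‖y' - X τ‖ ^ 2 = ‖z‖ ^ 2 + 2 * inner ℝ z (y' - (X τ + z))
        + ‖y' - (X τ + z)‖ ^ 2 := by
      conv_lhs => rw [h5]
      rw [norm_add_sq_real]
    have h7 := mul_le_mul_of_nonneg_left (sq_max_zero_le (s - T') (s' - T')) hM.le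
    rw [h6] at h4
    rw [inner_smul_left, Real.norm_eq_abs, sq_abs]
    simp only [map_neg, conj_trivial]
    have h8 : 0 ≤ (j + M) * ‖y' - (X τ + z)‖ ^ 2 := by positivity
    have h9 : 0 ≤ k * (s' - s) ^ 2 := by positivity
    linarith
  have hfin := hprox s hsI _ (hV τ hτ z hz) _ _ hsub
  rw [inner_smul_left] at hfin
  simp only [map_neg, conj_trivial] at hfin
  have hMx : 0 ≤ M * max 0 (s - T') := by positivity
  have hdiff : k * inner ℝ z (F τ (X τ) - F s (X τ + z)) ≤ ε / 4 := by
    have h1 := (hθ₂F s hs τ hτ (hsν.trans_le hν2)).le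
    have h2 := hFK s hs (X τ) (X τ + z)
    rw [show X τ - (X τ + z) = -z by abel, norm_neg] at h2
    have h3 : ‖F τ (X τ) - F s (X τ + z)‖ ≤ ε / (8 * k * R) + K * ‖z‖ := by
      rw [show F τ (X τ) - F s (X τ + z) =
        (F τ (X τ) - F s (X τ)) + (F s (X τ) - F s (X τ + z)) by abel]
      exact (norm_add_le _ _).trans (add_le_add h1 h2)
    calc k * inner ℝ z (F τ (X τ) - F s (X τ + z))
        ≤ k * (‖z‖ * (ε / (8 * k * R) + K * ‖z‖)) := by
          gcongr
          exact (real_inner_le_norm _ _).trans (by gcongr)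
      _ = k * ‖z‖ * (ε / (8 * k * R)) + k * ‖z‖ ^ 2 * K := by ring
      _ ≤ k * R * (ε / (8 * k * R)) + ε / 8 := by gcongr
      _ = ε / 4 := by field_simp; norm_num
  rw [inner_sub_right] at hdiff
  linarith

/-! ### Dini and proximal gradients -/

section DiniProximal

variable {n : ℕ} {Φ : ℝ → EuclideanSpace ℝ (Fin n) → ℝ} {t : ℝ} {x : EuclideanSpace ℝ (Fin n)}

/-- The points used in the Dini quotients converge to the base point within the domain. -/
theorem tendsto_diniFilter (u : ℝ) (v : EuclideanSpace ℝ (Fin n)) :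
    Tendsto (fun q : ℝ × EuclideanSpace ℝ (Fin n) => (t + q.1 * u, x + q.1 • q.2))
      (diniFilter t u v) (𝓝[Ici (0 : ℝ) ×ˢ univ] (t, x)) := by
  refine tendsto_nhdsWithin_iff.2 ⟨?_, ?_⟩
  · have h : Tendsto (fun q : ℝ × EuclideanSpace ℝ (Fin n) => (t + q.1 * u, x + q.1 • q.2))
        (𝓝 (0, v)) (𝓝 (t + 0 * u, x + (0 : ℝ) • v)) :=
      Continuous.tendsto (by fun_prop) _
    rw [zero_mul, add_zero, zero_smul, add_zero, nhds_prod_eq] at h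
    exact h.mono_left (inf_le_left.trans (prod_mono nhdsWithin_le_nhds le_rfl))
  · filter_upwards [mem_inf_of_right (mem_principal_self _)] with q hq
    exact ⟨hq, trivial⟩

theorem eventually_pos_diniFilter (u : ℝ) (v : EuclideanSpace ℝ (Fin n)) :
    ∀ᶠ q in diniFilter t u v, 0 < q.1 :=
  Filter.Eventually.filter_mono inf_le_left
    (Eventually.prod_inl (eventually_mem_nhdsWithin (a := (0 : ℝ)) (s := Ioi 0)) _)

/-- A quadratic error divided by the step keeps a factor `q.1`, so it vanishes in the limit. Either
sign of `σ` occurs: one for sub-gradients, the other for super-gradients. -/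
theorem tendsto_diniFilter_quadratic (u a σ : ℝ) (p v : EuclideanSpace ℝ (Fin n)) :
    Tendsto (fun q : ℝ × EuclideanSpace ℝ (Fin n) =>
        ((u * a + inner ℝ q.2 p + σ * q.1 * (u ^ 2 + ‖q.2‖ ^ 2) : ℝ) : EReal))
      (diniFilter t u v) (𝓝 ((u * a + inner ℝ v p : ℝ) : EReal)) := by
  refine (continuous_coe_real_ereal.tendsto _).comp ?_
  have h : Tendsto (fun q : ℝ × EuclideanSpace ℝ (Fin n) =>
      u * a + inner ℝ q.2 p + σ * q.1 * (u ^ 2 + ‖q.2‖ ^ 2)) (𝓝 (0, v))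
      (𝓝 (u * a + inner ℝ v p + σ * 0 * (u ^ 2 + ‖v‖ ^ 2))) :=
    Continuous.tendsto (by fun_prop) _
  rw [mul_zero, zero_mul, add_zero, nhds_prod_eq] at h
  exact h.mono_left (inf_le_left.trans (prod_mono nhdsWithin_le_nhds le_rfl))

theorem proxSubgrad_subset_diniSubgrad : proxSubgrad Φ t x ⊆ diniSubgrad Φ t x := by
  rintro ⟨a, p⟩ ⟨σ, -, U, hU, hUp⟩ u v
  refine (le_liminf_iff).2 fun y hy => ?_
  filter_upwards [(tendsto_diniFilter u v).eventually hU, eventually_pos_diniFilter u v,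
    (tendsto_diniFilter_quadratic u a (-σ) p v).eventually_const_lt hy] with q h1 h2 h3
  refine h3.trans_le (EReal.coe_le_coe_iff.2 ?_)
  rw [le_div_iff₀ h2]
  have h4 := hUp _ h1
  simp only [add_sub_cancel_left, norm_mul, norm_smul, mul_pow, Real.norm_eq_abs, sq_abs,
    inner_smul_right] at h4
  rw [real_inner_comm]
  linarith

/-- A local quadratic upper bound yields a Dini super-gradient. -/
theorem mem_diniSupergrad_of_eventually_le {a σ : ℝ} {p : EuclideanSpace ℝ (Fin n)}
    (h : ∀ᶠ q in 𝓝[Ici (0 : ℝ) ×ˢ univ] (t, x), Φ q.1 q.2 ≤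
      Φ t x + a * (q.1 - t) + inner ℝ p (q.2 - x) + σ * (‖q.1 - t‖ ^ 2 + ‖q.2 - x‖ ^ 2)) :
    (a, p) ∈ diniSupergrad Φ t x := by
  intro u v
  refine (limsup_le_iff).2 fun y hy => ?_
  filter_upwards [(tendsto_diniFilter u v).eventually h, eventually_pos_diniFilter u v,
    (tendsto_diniFilter_quadratic u a σ p v).eventually_lt_const hy] with q h4 h2 h3
  refine (EReal.coe_le_coe_iff.2 ?_).trans_lt h3
  rw [div_le_iff₀ h2]
  simp only [add_sub_cancel_left, norm_mul, norm_smul, mul_pow, Real.norm_eq_abs, sq_abs,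
    inner_smul_right] at h4
  rw [real_inner_comm]
  linarith

/-- Proximal sub-gradients after subtracting an affine function. -/
theorem proxSubgrad_of_sub_affine {α β s : ℝ} {ξ y : EuclideanSpace ℝ (Fin n)} {a : ℝ}
    {p : EuclideanSpace ℝ (Fin n)}
    (h : (a, p) ∈ proxSubgrad (fun s y => Φ s y - β - α * (s - t) - inner ℝ ξ (y - x)) s y) :
    (a + α, p + ξ) ∈ proxSubgrad Φ s y := by
  obtain ⟨σ, hσ, U, hU, hUp⟩ := h
  refine ⟨σ, hσ, U, hU, fun q hq => ?_⟩
  have := hUp q hq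
  have h2 : q.2 - x = (q.2 - y) + (y - x) := by abel
  simp only [h2] at this
  rw [inner_add_right] at this
  simp only [inner_add_left]
  linarith

/-- Along a compact set of velocities, a Dini sub-gradient bounds the increments of `Φ` from below,
uniformly on a neighbourhood of that set. -/
theorem exists_uniform_of_mem_diniSubgrad (ht : 0 ≤ t) {α : ℝ} {ξ : EuclideanSpace ℝ (Fin n)}
    (h : (α, ξ) ∈ diniSubgrad Φ t x) {C : Set (EuclideanSpace ℝ (Fin n))} (hC : IsCompact C)
    {ε : ℝ} (hε : 0 < ε) :
    ∃ r₀ > 0, ∃ η > 0, ∀ r, 0 < r → r ≤ r₀ → ∀ w ∈ Metric.cthickening η C,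
      r * (α - ε + inner ℝ ξ w) ≤ Φ (t + r) (x + r • w) - Φ t x := by
  have hloc : ∀ v ∈ C, {q : ℝ × EuclideanSpace ℝ (Fin n) |
      q.1 * (α - ε + inner ℝ ξ q.2) ≤ Φ (t + q.1) (x + q.1 • q.2) - Φ t x} ∈
        𝓝[>] (0 : ℝ) ×ˢ 𝓝 v := by
    intro v _
    have h1 : ((α + inner ℝ v ξ - ε / 2 : ℝ) : EReal) < lowerDini Φ t x 1 v := by
      refine lt_of_lt_of_le (EReal.coe_lt_coe_iff.2 ?_) (h 1 v)
      simp only; linarith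
    have h2 := eventually_lt_of_lt_liminf h1
    rw [diniFilter, eventually_inf_principal] at h2
    have h3 : ∀ᶠ q : ℝ × EuclideanSpace ℝ (Fin n) in 𝓝[>] (0 : ℝ) ×ˢ 𝓝 v, 0 < q.1 :=
      Eventually.prod_inl (eventually_mem_nhdsWithin (a := (0 : ℝ)) (s := Ioi 0)) _
    have h4 : ∀ᶠ q : ℝ × EuclideanSpace ℝ (Fin n) in 𝓝[>] (0 : ℝ) ×ˢ 𝓝 v,
        inner ℝ ξ q.2 < inner ℝ v ξ + ε / 2 := by
      refine Eventually.prod_inr (p := fun w => inner ℝ ξ w < inner ℝ v ξ + ε / 2) ?_ _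
      refine ((by fun_prop : Continuous fun w => inner ℝ ξ w).tendsto v).eventually_lt_const ?_
      rw [real_inner_comm]; linarith
    filter_upwards [h2, h3, h4] with q h5 h6 h7
    have h8 := EReal.coe_lt_coe_iff.1 (h5 (show (0 : ℝ) ≤ t + q.1 * 1 by linarith))
    rw [lt_div_iff₀ h6, mul_one] at h8
    refine le_trans ?_ h8.le
    rw [mul_comm]
    exact mul_le_mul_of_nonneg_right (by linarith) h6.le
  -- Compactness glues the neighbourhoods of single directions, giving one step bound and one
  -- thickening.
  have hset := hC.mem_prod_nhdsSet_of_forall hloc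
  rw [mem_prod_iff] at hset
  obtain ⟨A, hA, D, hD, hAD⟩ := hset
  obtain ⟨r₀, hr₀, hr₀A⟩ := (nhdsGT_basis_Ioc (0 : ℝ)).mem_iff.1 hA
  obtain ⟨η, hη, hηD⟩ := (Metric.hasBasis_nhdsSet_cthickening hC).mem_iff.1 hD
  exact ⟨r₀, hr₀, η, hη, fun r h1 h2 w hw => hAD (show (r, w) ∈ A ×ˢ D from
    ⟨hr₀A ⟨h1, h2⟩, hηD hw⟩)⟩

end DiniProximal

/-! ### Uniform continuity and existence of trajectories -/

/-- Continuity in the base point, uniformly over a compact set of parameters. -/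
theorem exists_uniform_dist_lt {E E' F : Type*} [NormedAddCommGroup E] [NormedSpace ℝ E]
    [FiniteDimensional ℝ E] [PseudoMetricSpace E'] [PseudoMetricSpace F] {g : ℝ → E → E' → F}
    (hg : ContinuousOn (fun p : ℝ × E × E' => g p.1 p.2.1 p.2.2) (Ici (0 : ℝ) ×ˢ univ))
    {Ω : Set E'} (hΩ : IsCompact Ω) {t : ℝ} (ht : 0 ≤ t) (x : E) {ε : ℝ} (hε : 0 < ε) :
    ∃ ρ > 0, ∀ s, 0 ≤ s → |s - t| ≤ ρ → ∀ y, ‖y - x‖ ≤ ρ → ∀ u ∈ Ω,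
      dist (g s y u) (g t x u) < ε := by
  have : ProperSpace E := FiniteDimensional.proper ℝ E
  have hc : IsCompact (Icc 0 (t + 1) ×ˢ Metric.closedBall x 1 ×ˢ Ω) :=
    isCompact_Icc.prod ((isCompact_closedBall _ _).prod hΩ)
  obtain ⟨ρ, hρ, h⟩ := Metric.uniformContinuousOn_iff.1
    (hc.uniformContinuousOn_of_continuous (hg.mono fun p hp => ⟨hp.1.1, trivial⟩)) ε hε
  refine ⟨min (ρ / 2) 1, by positivity, fun s hs hst y hy u hu => ?_⟩
  have h1 : |s - t| < ρ := by linarith [min_le_left (ρ / 2) 1]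
  have h2 : ‖y - x‖ < ρ := by linarith [min_le_left (ρ / 2) 1]
  refine h (s, y, u) ⟨⟨hs, ?_⟩, ?_, hu⟩ (t, x, u) ⟨⟨ht, by simp⟩, by simp, hu⟩ ?_
  · have := (abs_le.1 hst).2
    simp only
    linarith [min_le_right (ρ / 2) 1]
  · simpa [dist_eq_norm] using hy.trans (min_le_right _ _)
  · simp only [Prod.dist_eq, dist_self, Real.dist_eq, dist_eq_norm y x]
    exact max_lt h1 (max_lt h2 hρ)

/-- Local existence of trajectories of a continuous, globally Lipschitz, time-dependent field. -/
theorem exists_trajectory {E : Type*} [NormedAddCommGroup E] [NormedSpace ℝ E]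
    [FiniteDimensional ℝ E] {F : ℝ → E → E} (hF : Continuous fun p : ℝ × E => F p.1 p.2) {K : ℝ}
    (hFK : ∀ s y z, ‖F s y - F s z‖ ≤ K * ‖y - z‖) (t : ℝ) (x : E) :
    ∃ ρ > 0, ∃ X : ℝ → E, X t = x ∧ ∀ s ∈ Ioo (t - ρ) (t + ρ), HasDerivAt X (F s (X s)) s := by
  have : CompleteSpace E := FiniteDimensional.complete ℝ E
  have : ProperSpace E := FiniteDimensional.proper ℝ E
  obtain ⟨L, hL⟩ := (isCompact_Icc.prod (isCompact_closedBall x 1)).exists_bound_of_continuousOn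
    (s := Icc (t - 1) (t + 1) ×ˢ Metric.closedBall x 1) hF.continuousOn
  -- The speed is at most `L` on the unit ball around `x`, so the solution stays there for time `ρ`.
  set ρ : ℝ := min 1 (1 / (|L| + 1)) with hρ
  have hρ0 : 0 < ρ := by positivity
  have hρ1 : ρ ≤ 1 := min_le_left _ _
  have hPL : IsPicardLindelof F (tmin := t - ρ) (tmax := t + ρ) ⟨t, by constructor <;> linarith⟩
      x 1 0 L.toNNReal K.toNNReal := by
    refine ⟨fun s hs => ?_, fun y hy => ?_, fun s hs y hy => ?_, ?_⟩
    · refine LipschitzOnWith.of_dist_le_mul fun y _ z _ => ?_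
      rw [dist_eq_norm, dist_eq_norm]
      exact (hFK s y z).trans (by gcongr; exact Real.le_coe_toNNReal K)
    · exact (hF.comp (by fun_prop : Continuous fun s : ℝ => (s, y))).continuousOn
    · exact (hL (s, y) ⟨⟨by linarith [hs.1], by linarith [hs.2]⟩, hy⟩).trans
        (Real.le_coe_toNNReal L)
    · have h1 : (L.toNNReal : ℝ) ≤ |L| + 1 := by
        rw [Real.coe_toNNReal']
        exact max_le (by linarith [le_abs_self L]) (by positivity)
      simp only [add_sub_cancel_left, sub_sub_cancel, max_self]
      calc (L.toNNReal : ℝ) * ρ ≤ (|L| + 1) * (1 / (|L| + 1)) := by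
            gcongr; exact min_le_right _ _
        _ = ((1 : NNReal) : ℝ) - ((0 : NNReal) : ℝ) := by
            have : |L| + 1 ≠ 0 := by positivity
            field_simp; simp
  obtain ⟨X, hX0, hX⟩ := hPL.exists_eq_forall_mem_Icc_hasDerivWithinAt₀
  exact ⟨ρ, hρ0, X, hX0, fun s hs => (hX s (Ioo_subset_Icc_self hs)).hasDerivAt
    (Icc_mem_nhds hs.1 hs.2)⟩

/-! ### Transfer of the Hamilton–Jacobi inequalities -/

section HamiltonJacobi

variable {n m : ℕ} {δ : ℝ} {l : ℝ → EuclideanSpace ℝ (Fin n) → EuclideanSpace ℝ (Fin m) → ℝ}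
  {f : ℝ → EuclideanSpace ℝ (Fin n) → EuclideanSpace ℝ (Fin m) → EuclideanSpace ℝ (Fin n)}
  {Ω : Set (EuclideanSpace ℝ (Fin m))} {Φ : ℝ → EuclideanSpace ℝ (Fin n) → ℝ}

theorem continuousOn_preHamiltonian
    (hl : ContinuousOn
      (fun p : ℝ × EuclideanSpace ℝ (Fin n) × EuclideanSpace ℝ (Fin m) => l p.1 p.2.1 p.2.2)
      (Ici (0 : ℝ) ×ˢ univ))
    (hf : ContinuousOn
      (fun p : ℝ × EuclideanSpace ℝ (Fin n) × EuclideanSpace ℝ (Fin m) => f p.1 p.2.1 p.2.2)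
      (Ici (0 : ℝ) ×ˢ univ)) (ξ : EuclideanSpace ℝ (Fin n)) :
    ContinuousOn (fun p : ℝ × EuclideanSpace ℝ (Fin n) × EuclideanSpace ℝ (Fin m) =>
      preHamiltonian δ l f p.1 p.2.1 ξ p.2.2) (Ici (0 : ℝ) ×ˢ univ) := by
  unfold preHamiltonian
  exact (continuousOn_const.inner hf).add (ContinuousOn.mul (by fun_prop) hl)

/-- The pre-Hamiltonian dominates the Hamiltonian. -/
theorem hamiltonian_le_preHamiltonian
    (hl : ContinuousOn
      (fun p : ℝ × EuclideanSpace ℝ (Fin n) × EuclideanSpace ℝ (Fin m) => l p.1 p.2.1 p.2.2)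
      (Ici (0 : ℝ) ×ˢ univ))
    (hf : ContinuousOn
      (fun p : ℝ × EuclideanSpace ℝ (Fin n) × EuclideanSpace ℝ (Fin m) => f p.1 p.2.1 p.2.2)
      (Ici (0 : ℝ) ×ˢ univ)) (hΩ : IsCompact Ω) {t : ℝ} (ht : 0 ≤ t)
    (x ξ : EuclideanSpace ℝ (Fin n)) {u : EuclideanSpace ℝ (Fin m)} (hu : u ∈ Ω) :
    hamiltonian δ l f Ω t x ξ ≤ preHamiltonian δ l f t x ξ u := by
  refine csInf_le (hΩ.bddBelow_image ?_) (mem_image_of_mem _ hu)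
  exact (continuousOn_preHamiltonian hl hf ξ).comp
    (f := fun u : EuclideanSpace ℝ (Fin m) => (t, x, u)) (by fun_prop) fun u _ => ⟨ht, trivial⟩

/-- The inequality `α + 𝓗 ≤ 0` passes from proximal sub-gradients at nearby points to Dini
sub-gradients. -/
theorem add_hamiltonian_nonpos_of_mem_diniSubgrad (hΩn : Ω.Nonempty)
    (hl : ContinuousOn
      (fun p : ℝ × EuclideanSpace ℝ (Fin n) × EuclideanSpace ℝ (Fin m) => l p.1 p.2.1 p.2.2)
      (Ici (0 : ℝ) ×ˢ univ))
    (hf : ContinuousOn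
      (fun p : ℝ × EuclideanSpace ℝ (Fin n) × EuclideanSpace ℝ (Fin m) => f p.1 p.2.1 p.2.2)
      (Ici (0 : ℝ) ×ˢ univ)) (hΩ : IsCompact Ω)
    (hΦ : ContinuousOn (fun p : ℝ × EuclideanSpace ℝ (Fin n) => Φ p.1 p.2)
      (Ici (0 : ℝ) ×ˢ univ))
    {t : ℝ} (ht : 0 ≤ t) {x : EuclideanSpace ℝ (Fin n)} (hconv : Convex ℝ (f t x '' Ω))
    (hprox : ∀ s, 0 ≤ s → (0 < t → 0 < s) → ∀ y, ∀ p ∈ proxSubgrad Φ s y,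
      p.1 + hamiltonian δ l f Ω s y p.2 ≤ 0)
    {α : ℝ} {ξ : EuclideanSpace ℝ (Fin n)} (hαξ : (α, ξ) ∈ diniSubgrad Φ t x) :
    α + hamiltonian δ l f Ω t x ξ ≤ 0 := by
  by_contra! hpos
  -- The four `ε` pay for the tilt of `α`, the defect `κ` of the cone lemma, the variation of the
  -- pre-Hamiltonian, and the choice of a nearly optimal control.
  obtain ⟨ε, hε, hαε⟩ : ∃ ε : ℝ, 0 < ε ∧ α + hamiltonian δ l f Ω t x ξ = 4 * ε :=
    ⟨(α + hamiltonian δ l f Ω t x ξ) / 4, by positivity, by ring⟩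
  have hCc : IsCompact (f t x '' Ω) :=
    hΩ.image_of_continuousOn (hf.comp (f := fun u : EuclideanSpace ℝ (Fin m) => (t, x, u))
      (by fun_prop) fun u _ => ⟨ht, trivial⟩)
  obtain ⟨r₀, hr₀, η, hη, hcone⟩ := exists_uniform_of_mem_diniSubgrad ht hαξ hCc hε
  -- Half of `η` lets `C` contain the velocities `f s y u` at nearby points; the other half is the
  -- opening required by the cone lemma.
  set C := Metric.cthickening (η / 2) (f t x '' Ω) with hC
  have hCc' : IsCompact C := hCc.cthickening
  obtain ⟨b, hb⟩ := hCc'.isBounded.exists_norm_le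
  obtain ⟨ρ₁, hρ₁, hf₁⟩ := exists_uniform_dist_lt hf hΩ ht x (half_pos hη)
  obtain ⟨ρ₂, hρ₂, hH₂⟩ := exists_uniform_dist_lt (g := fun s y u => preHamiltonian δ l f s y ξ u)
    (continuousOn_preHamiltonian (δ := δ) hl hf ξ) hΩ ht x hε
  set R := min ρ₁ ρ₂ with hR
  have hR0 : 0 < R := lt_min hρ₁ hρ₂
  set r := min r₀ (min R (R / (4 * (|b| + 1)))) with hr
  have hr0 : 0 < r := lt_min hr₀ (lt_min hR0 (by positivity))
  have hrR : r ≤ R := (min_le_right _ _).trans (min_le_left _ _)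
  have hrb : 4 * r * |b| < R := by
    have h1 : r ≤ R / (4 * (|b| + 1)) := (min_le_right _ _).trans (min_le_right _ _)
    rw [le_div_iff₀ (by positivity)] at h1
    linarith
  have hGc : ContinuousOn (fun p : ℝ × EuclideanSpace ℝ (Fin n) =>
      Φ p.1 p.2 - Φ t x - (α - ε) * (p.1 - t) - inner ℝ ξ (p.2 - x)) (Ici (0 : ℝ) ×ˢ univ) :=
    ((hΦ.sub continuousOn_const).sub (by fun_prop)).sub (by fun_prop)
  obtain ⟨s, y, a, p, hs0, hst, hsr, hyR, hap, hineq⟩ := exists_proxSubgrad_of_nonneg_on_cone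
    (G := fun s y => Φ s y - Φ t x - (α - ε) * (s - t) - inner ℝ ξ (y - x)) hGc ht
    (x := x) (by simp) hCc' (hconv.cthickening _)
    ((hΩn.image _).mono (Metric.self_subset_cthickening _))
    (fun c hc => (hb c hc).trans (le_abs_self b)) (half_pos hη) hr0 hR0 hε hrb (by
      intro w c hc hwc
      have hw : w ∈ Metric.cthickening η (f t x '' Ω) := by
        have h1 : w ∈ Metric.cthickening (η / 2) C :=
          Metric.mem_cthickening_of_dist_le w c _ _ hc (by rwa [dist_eq_norm])
        have h2 := Metric.cthickening_cthickening_subset (half_pos hη).le (half_pos hη).le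
          (f t x '' Ω) h1
        rwa [add_halves] at h2
      have := hcone r hr0 (min_le_left _ _) w hw
      simp only [add_sub_cancel_left, inner_smul_right]
      linarith)
  have hham := hprox s hs0 hst y _ (proxSubgrad_of_sub_affine hap)
  obtain ⟨_, ⟨u, hu, rfl⟩, hlt⟩ := exists_lt_of_csInf_lt
    (s := (fun u => preHamiltonian δ l f s y (p + ξ) u) '' Ω) (hΩn.image _)
    (b := -(a + (α - ε)) + ε) (by
      change hamiltonian δ l f Ω s y (p + ξ) < _
      linarith)
  have h1 : preHamiltonian δ l f s y (p + ξ) u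
      = inner ℝ p (f s y u) + preHamiltonian δ l f s y ξ u := by
    simp only [preHamiltonian, inner_add_left]; ring
  have h2 := hH₂ s hs0 ((hsr.trans hrR).trans (min_le_right _ _)) y
    (hyR.trans (min_le_right _ _)) u hu
  have h3 := hf₁ s hs0 ((hsr.trans hrR).trans (min_le_left _ _)) y
    (hyR.trans (min_le_left _ _)) u hu
  have h4 := hamiltonian_le_preHamiltonian (δ := δ) hl hf hΩ ht x ξ hu
  have h5 := hineq (f s y u)
    (Metric.mem_cthickening_of_dist_le _ _ _ _ (mem_image_of_mem _ hu) h3.le)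
  rw [Real.dist_eq] at h2
  have h6 := (abs_lt.1 h2).1
  simp only at hlt
  linarith

/-- The trajectories of a constant control: the dynamics are frozen before time `0`. -/
theorem exists_trajectory_of_control
    (hlip : ∃ K₁ : ℝ, 0 < K₁ ∧ ∀ t : ℝ, 0 ≤ t → ∀ u ∈ Ω, ∀ x z : EuclideanSpace ℝ (Fin n),
      |l t x u - l t z u| + ‖f t x u - f t z u‖ ≤ K₁ * ‖x - z‖)
    (hl : ContinuousOn
      (fun p : ℝ × EuclideanSpace ℝ (Fin n) × EuclideanSpace ℝ (Fin m) => l p.1 p.2.1 p.2.2)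
      (Ici (0 : ℝ) ×ˢ univ))
    (hf : ContinuousOn
      (fun p : ℝ × EuclideanSpace ℝ (Fin n) × EuclideanSpace ℝ (Fin m) => f p.1 p.2.1 p.2.2)
      (Ici (0 : ℝ) ×ˢ univ))
    {u : EuclideanSpace ℝ (Fin m)} (hu : u ∈ Ω) {t : ℝ} (ht : 0 ≤ t)
    (x : EuclideanSpace ℝ (Fin n)) {c : ℝ} (hc : Real.exp (-δ * t) * l t x u < c) :
    ∃ ρ > 0, ∃ R > 0, ∃ X : ℝ → EuclideanSpace ℝ (Fin n), X t = x ∧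
      (∀ s ∈ Icc (t - ρ) (t + ρ), HasDerivAt X (f (max s 0) (X s) u) s) ∧
      (∀ s ∈ Icc (t - ρ) (t + ρ), ∀ z, ‖z‖ ≤ R → X s + z ∈ Metric.closedBall x (2 * R)) ∧
      ∀ s ∈ Icc (t - ρ) (t + ρ), 0 ≤ s → ∀ y ∈ Metric.closedBall x (2 * R),
        Real.exp (-δ * s) * l s y u ≤ c := by
  obtain ⟨K, hK, hlip⟩ := hlip
  have hFc : Continuous fun p : ℝ × EuclideanSpace ℝ (Fin n) => f (max p.1 0) p.2 u := by
    rw [← continuousOn_univ]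
    exact hf.comp (f := fun p : ℝ × EuclideanSpace ℝ (Fin n) => (max p.1 0, p.2, u))
      (by fun_prop) fun p _ => ⟨mem_Ici.2 (le_max_right _ _), trivial⟩
  obtain ⟨ρ₁, hρ₁, X, hXt, hX⟩ := exists_trajectory (F := fun s y => f (max s 0) y u) hFc
    (K := K) (fun s y z => by
      have := hlip (max s 0) (le_max_right _ _) u hu y z
      linarith [abs_nonneg (l (max s 0) y u - l (max s 0) z u)]) t x
  have hLc : ContinuousOn (fun p : ℝ × EuclideanSpace ℝ (Fin n) =>
      Real.exp (-δ * p.1) * l p.1 p.2 u) (Ici (0 : ℝ) ×ˢ univ) :=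
    ContinuousOn.mul (by fun_prop)
      (hl.comp (f := fun p : ℝ × EuclideanSpace ℝ (Fin n) => (p.1, p.2, u)) (by fun_prop)
        fun p hp => ⟨hp.1, trivial⟩)
  obtain ⟨ρ₂, hρ₂, hL⟩ := Metric.mem_nhdsWithin_iff.1
    ((hLc (t, x) ⟨ht, trivial⟩).eventually_lt_const hc)
  have hXc : ContinuousAt X t := (hX t ⟨by linarith, by linarith⟩).continuousAt
  -- One third of `ρ₂` for the drift of `X` and one for `z`, so the tube stays strictly inside the
  -- ball.
  obtain ⟨ρ₃, hρ₃, hX₃⟩ := Metric.continuousAt_iff.1 hXc (ρ₂ / 3) (by positivity)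
  obtain ⟨ρ, hρ, h1, h2, h3⟩ : ∃ ρ > 0, ρ < ρ₁ ∧ ρ < ρ₂ ∧ ρ < ρ₃ := by
    obtain ⟨ρ, h0, h⟩ := exists_between (lt_min hρ₁ (lt_min hρ₂ hρ₃))
    exact ⟨ρ, h0, (lt_min_iff.1 h).1, lt_min_iff.1 (lt_min_iff.1 h).2⟩
  have habs : ∀ s ∈ Icc (t - ρ) (t + ρ), dist s t ≤ ρ := fun s hs => by
    rw [Real.dist_eq, abs_le]; constructor <;> linarith [hs.1, hs.2]
  refine ⟨ρ, hρ, ρ₂ / 3, by positivity, X, hXt, fun s hs => hX s ⟨by linarith [hs.1],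
    by linarith [hs.2]⟩, fun s hs z hz => ?_, fun s hs hs0 y hy => ?_⟩
  · have h4 := hX₃ ((habs s hs).trans_lt h3)
    rw [hXt, dist_eq_norm] at h4
    rw [Metric.mem_closedBall, dist_eq_norm, add_sub_right_comm]
    linarith [norm_add_le (X s - x) z]
  · refine le_of_lt (hL (show (s, y) ∈ _ from ⟨?_, hs0, trivial⟩))
    rw [Metric.mem_ball, Prod.dist_eq]
    refine max_lt ((habs s hs).trans_lt h2) ?_
    rw [Metric.mem_closedBall] at hy
    simp only
    linarith

/-- Velocities of the chords of a differentiable curve. -/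
theorem tendsto_chord {E : Type*} [NormedAddCommGroup E] [NormedSpace ℝ E] {X : ℝ → E} {v : E}
    {t : ℝ} (h : HasDerivAt X v t) :
    Tendsto (fun r => r⁻¹ • (X (t + r) - X t)) (𝓝[>] 0) (𝓝 v) :=
  (hasDerivAt_iff_tendsto_slope_zero.1 h).mono_left (nhdsWithin_mono _ fun _ hr => ne_of_gt hr)

theorem tendsto_backward_chord {E : Type*} [NormedAddCommGroup E] [NormedSpace ℝ E] {X : ℝ → E}
    {v : E} {t : ℝ} (h : HasDerivAt X v t) :
    Tendsto (fun r => r⁻¹ • (X t - X (t - r))) (𝓝[>] 0) (𝓝 v) := by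
  have h1 : Tendsto (fun r : ℝ => -r) (𝓝[>] 0) (𝓝[≠] 0) := by
    refine tendsto_nhdsWithin_iff.2 ⟨?_, ?_⟩
    · exact ((continuous_neg.tendsto' (0 : ℝ) 0 neg_zero)).mono_left nhdsWithin_le_nhds
    · filter_upwards [self_mem_nhdsWithin] with r hr
      exact neg_ne_zero.2 (ne_of_gt hr)
  refine ((hasDerivAt_iff_tendsto_slope_zero.1 h).comp h1).congr fun r => ?_
  simp only [Function.comp, inv_neg, neg_smul, ← smul_neg, neg_sub, sub_eq_add_neg t r]

/-- The inequality `0 ≤ α + 𝓗` passes from proximal sub-gradients at positive times to Dini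
super-gradients. -/
theorem add_hamiltonian_nonneg_of_mem_diniSupergrad (hΩn : Ω.Nonempty)
    (hlip : ∃ K₁ : ℝ, 0 < K₁ ∧ ∀ t : ℝ, 0 ≤ t → ∀ u ∈ Ω, ∀ x z : EuclideanSpace ℝ (Fin n),
      |l t x u - l t z u| + ‖f t x u - f t z u‖ ≤ K₁ * ‖x - z‖)
    (hl : ContinuousOn
      (fun p : ℝ × EuclideanSpace ℝ (Fin n) × EuclideanSpace ℝ (Fin m) => l p.1 p.2.1 p.2.2)
      (Ici (0 : ℝ) ×ˢ univ))
    (hf : ContinuousOn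
      (fun p : ℝ × EuclideanSpace ℝ (Fin n) × EuclideanSpace ℝ (Fin m) => f p.1 p.2.1 p.2.2)
      (Ici (0 : ℝ) ×ˢ univ)) (hΩ : IsCompact Ω)
    (hΦ : ContinuousOn (fun p : ℝ × EuclideanSpace ℝ (Fin n) => Φ p.1 p.2)
      (Ici (0 : ℝ) ×ˢ univ))
    (hprox : ∀ s, 0 < s → ∀ y, ∀ p ∈ proxSubgrad Φ s y,
      0 ≤ p.1 + hamiltonian δ l f Ω s y p.2)
    {t : ℝ} (ht : 0 ≤ t) {x : EuclideanSpace ℝ (Fin n)}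
    {α : ℝ} {ξ : EuclideanSpace ℝ (Fin n)} (hαξ : (α, ξ) ∈ diniSupergrad Φ t x) :
    0 ≤ α + hamiltonian δ l f Ω t x ξ := by
  suffices h : ∀ u ∈ Ω, -α ≤ preHamiltonian δ l f t x ξ u by
    have : -α ≤ hamiltonian δ l f Ω t x ξ :=
      le_csInf (hΩn.image _) (by rintro _ ⟨u, hu, rfl⟩; exact h u hu)
    linarith
  intro u hu
  -- A strict upper bound `c` for the running cost persists near `(t, x)`, which gives a constant
  -- rate for the monotonicity lemma; then `c` decreases to the cost.
  have key : ∀ c, Real.exp (-δ * t) * l t x u < c → -α - inner ℝ ξ (f t x u) ≤ c := by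
    intro c hc
    obtain ⟨ρ, hρ, R, hR, X, hXt, hX, hXR, hLc⟩ :=
      exists_trajectory_of_control hlip hl hf hu ht x hc
    have hmono : ∀ r, 0 < r → r ≤ ρ → Φ t x - c * r ≤ Φ (t + r) (X (t + r)) := by
      intro r hr hrρ
      have hsub : Icc t (t + r) ⊆ Icc (t - ρ) (t + ρ) := Icc_subset_Icc (by linarith) (by linarith)
      have hK := hlip
      obtain ⟨K, hK0, hK⟩ := hK
      have := sub_mul_le_of_proxSubgrad_along_trajectory (Φ := Φ) (T₀ := t) (T₁ := t + r)
        (by linarith) (hΦ.mono fun p hp => ⟨ht.trans hp.1.1, trivial⟩)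
        (F := fun s y => f s y u)
        (hf.comp (f := fun p : ℝ × EuclideanSpace ℝ (Fin n) => (p.1, p.2, u)) (by fun_prop)
          fun p hp => ⟨ht.trans hp.1.1, trivial⟩)
        hK0.le (fun s hs y z => by
          have := hK s (ht.trans hs.1) u hu y z
          linarith [abs_nonneg (l s y u - l s z u)])
        (X := X) (fun s hs => (hX s (hsub hs)).continuousAt.continuousWithinAt)
        (fun s hs => by
          have := hX s (hsub (Ioo_subset_Icc_self hs))
          rwa [max_eq_left (ht.trans hs.1.le)] at this)
        hR (fun s hs => hXR s (hsub hs)) (c := c) (fun s hs y hy a p hap => by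
          have h1 := hprox s (ht.trans_lt hs.1) y _ hap
          have h2 := hamiltonian_le_preHamiltonian (δ := δ) hl hf hΩ (ht.trans hs.1.le) y p hu
          have h3 := hLc s (hsub (Ioo_subset_Icc_self hs)) (ht.trans hs.1.le) y hy
          simp only [preHamiltonian] at h1 h2
          linarith)
      rwa [hXt, add_sub_cancel_left] at this
    have hder := hX t ⟨by linarith, by linarith⟩
    rw [max_eq_left ht, hXt] at hder
    have hchord := tendsto_chord hder
    have htend : Tendsto (fun r => (r, r⁻¹ • (X (t + r) - X t))) (𝓝[>] 0)
        (diniFilter t 1 (f t x u)) := by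
      refine tendsto_inf.2 ⟨tendsto_id.prodMk hchord, tendsto_principal.2 ?_⟩
      filter_upwards [self_mem_nhdsWithin] with r hr
      have : (0 : ℝ) < r := hr
      change 0 ≤ t + r * 1
      linarith
    have hev : ∀ᶠ r in 𝓝[>] (0 : ℝ), ((-c : ℝ) : EReal) ≤
        (((Φ (t + r * 1) (x + r • r⁻¹ • (X (t + r) - X t)) - Φ t x) / r : ℝ) : EReal) := by
      filter_upwards [Ioc_mem_nhdsGT hρ] with r hr
      rw [EReal.coe_le_coe_iff, le_div_iff₀ hr.1, smul_inv_smul₀ hr.1.ne', hXt,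
        add_sub_cancel, mul_one]
      linarith [hmono r hr.1 hr.2]
    -- The chords are admissible directions tending to `f t x u`, and for a limsup a bound along
    -- this one curve suffices.
    have hup : ((-c : ℝ) : EReal) ≤ upperDini Φ t x 1 (f t x u) :=
      le_limsup_of_frequently_le (htend.frequently hev.frequently)
    have := EReal.coe_le_coe_iff.1 (hup.trans (hαξ 1 (f t x u)))
    rw [real_inner_comm] at this
    simp only at this
    linarith
  have := le_of_forall_gt_imp_ge_of_dense key
  simp only [preHamiltonian]
  linarith

/-- Proximal sub-gradients of the time reversal of `-Φ` are Dini super-gradients of `Φ`. -/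
theorem mem_diniSupergrad_of_reversal {T s : ℝ} (hs : 0 < s)
    {y : EuclideanSpace ℝ (Fin n)} {a : ℝ} {p : EuclideanSpace ℝ (Fin n)}
    (h : (a, p) ∈ proxSubgrad (fun s y => -Φ (T - s) y) s y) :
    (a, -p) ∈ diniSupergrad Φ (T - s) y := by
  obtain ⟨σ, -, U, hU, hUp⟩ := h
  have hU' : U ∈ 𝓝 (s, y) := by
    rwa [nhdsWithin_eq_nhds.2 (prod_mem_nhds (Ici_mem_nhds hs) univ_mem)] at hU
  have hmap : Tendsto (fun q : ℝ × EuclideanSpace ℝ (Fin n) => (T - q.1, q.2))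
      (𝓝 (T - s, y)) (𝓝 (s, y)) :=
    Continuous.tendsto' (by fun_prop) _ _ (by simp)
  refine mem_diniSupergrad_of_eventually_le (σ := σ) (mem_nhdsWithin_of_mem_nhds ?_)
  filter_upwards [hmap hU'] with q hq
  have h1 := hUp _ hq
  simp only [sub_sub_cancel] at h1
  have h2 : ‖T - q.1 - s‖ = ‖q.1 - (T - s)‖ := by rw [← norm_neg]; congr 1; ring
  rw [h2] at h1
  rw [inner_neg_left]
  linarith

/-- The inequality `0 ≤ α + 𝓗` passes from Dini super-gradients at positive times to proximal
sub-gradients at positive times. -/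
theorem add_hamiltonian_nonneg_of_mem_proxSubgrad (hΩn : Ω.Nonempty)
    (hlip : ∃ K₁ : ℝ, 0 < K₁ ∧ ∀ t : ℝ, 0 ≤ t → ∀ u ∈ Ω, ∀ x z : EuclideanSpace ℝ (Fin n),
      |l t x u - l t z u| + ‖f t x u - f t z u‖ ≤ K₁ * ‖x - z‖)
    (hl : ContinuousOn
      (fun p : ℝ × EuclideanSpace ℝ (Fin n) × EuclideanSpace ℝ (Fin m) => l p.1 p.2.1 p.2.2)
      (Ici (0 : ℝ) ×ˢ univ))
    (hf : ContinuousOn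
      (fun p : ℝ × EuclideanSpace ℝ (Fin n) × EuclideanSpace ℝ (Fin m) => f p.1 p.2.1 p.2.2)
      (Ici (0 : ℝ) ×ˢ univ)) (hΩ : IsCompact Ω)
    (hΦ : ContinuousOn (fun p : ℝ × EuclideanSpace ℝ (Fin n) => Φ p.1 p.2)
      (Ici (0 : ℝ) ×ˢ univ))
    (hsuper : ∀ s, 0 < s → ∀ y, ∀ p ∈ diniSupergrad Φ s y,
      0 ≤ p.1 + hamiltonian δ l f Ω s y p.2)
    {t : ℝ} (ht : 0 < t) {x : EuclideanSpace ℝ (Fin n)}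
    {α : ℝ} {ξ : EuclideanSpace ℝ (Fin n)} (hαξ : (α, ξ) ∈ proxSubgrad Φ t x) :
    0 ≤ α + hamiltonian δ l f Ω t x ξ := by
  suffices h : ∀ u ∈ Ω, -α ≤ preHamiltonian δ l f t x ξ u by
    have : -α ≤ hamiltonian δ l f Ω t x ξ :=
      le_csInf (hΩn.image _) (by rintro _ ⟨u, hu, rfl⟩; exact h u hu)
    linarith
  intro u hu
  have key : ∀ c, Real.exp (-δ * t) * l t x u < c → -α - inner ℝ ξ (f t x u) ≤ c := by
    intro c hc
    obtain ⟨ρ, hρ, R, hR, X, hXt, hX, hXR, hLc⟩ :=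
      exists_trajectory_of_control hlip hl hf hu ht.le x hc
    have hmono : ∀ r, 0 < r → r ≤ ρ → r < t → Φ (t - r) (X (t - r)) ≤ Φ t x + c * r := by
      intro r hr hrρ hrt
      have hrev : ∀ s ∈ Icc (t - r) t, 2 * t - r - s ∈ Icc (t - r) t := fun s hs =>
        ⟨by linarith [hs.2], by linarith [hs.1]⟩
      have hrev' : ∀ s ∈ Ioo (t - r) t, 2 * t - r - s ∈ Ioo (t - r) t := fun s hs =>
        ⟨by linarith [hs.2], by linarith [hs.1]⟩
      have hpos : ∀ s ∈ Icc (t - r) t, 0 < s := fun s hs => by linarith [hs.1]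
      have hsub : Icc (t - r) t ⊆ Icc (t - ρ) (t + ρ) := Icc_subset_Icc (by linarith) (by linarith)
      have hK := hlip
      obtain ⟨K, hK0, hK⟩ := hK
      -- The reflection `s ↦ 2 * t - r - s` exchanges `t - r` and `t`, and the reversed curve solves
      -- the equation with field `-f`.
      have := sub_mul_le_of_proxSubgrad_along_trajectory (Φ := fun s y => -Φ (2 * t - r - s) y)
        (T₀ := t - r) (T₁ := t) (by linarith)
        (hΦ.comp (f := fun p : ℝ × EuclideanSpace ℝ (Fin n) => (2 * t - r - p.1, p.2))
          (by fun_prop) fun p hp => ⟨(hpos _ (hrev _ hp.1)).le, trivial⟩).neg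
        (F := fun s y => -f (2 * t - r - s) y u)
        (hf.comp (f := fun p : ℝ × EuclideanSpace ℝ (Fin n) => (2 * t - r - p.1, p.2, u))
          (by fun_prop) fun p hp => ⟨(hpos _ (hrev _ hp.1)).le, trivial⟩).neg
        hK0.le (fun s hs y z => by
          have := hK _ (hpos _ (hrev _ hs)).le u hu y z
          rw [neg_sub_neg, norm_sub_rev]
          linarith [abs_nonneg (l (2 * t - r - s) y u - l (2 * t - r - s) z u)])
        (X := fun s => X (2 * t - r - s))
        (fun s hs => ((hX _ (hsub (hrev s hs))).continuousAt.comp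
          (f := fun s => 2 * t - r - s) (by fun_prop)).continuousWithinAt)
        (fun s hs => by
          have h1 := hrev _ (Ioo_subset_Icc_self hs)
          have h2 := hX _ (hsub h1)
          rw [max_eq_left (hpos _ h1).le] at h2
          have h3 := h2.scomp s ((hasDerivAt_id s).const_sub (2 * t - r))
          rw [neg_one_smul] at h3
          exact h3)
        hR (fun s hs => hXR _ (hsub (hrev s hs))) (c := c) (fun s hs y hy a p hap => by
          have h0 := hrev _ (Ioo_subset_Icc_self hs)
          have hs0 := hpos _ h0
          have h1 := hsuper _ hs0 y _ (mem_diniSupergrad_of_reversal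
            (hpos s (Ioo_subset_Icc_self hs)) hap)
          have h2 := hamiltonian_le_preHamiltonian (δ := δ) hl hf hΩ hs0.le y (-p) hu
          have h3 := hLc _ (hsub h0) hs0.le y hy
          simp only [preHamiltonian, inner_neg_left] at h1 h2
          rw [inner_neg_right]
          linarith)
      have e1 : 2 * t - r - (t - r) = t := by ring
      have e2 : 2 * t - r - t = t - r := by ring
      simp only [e1, e2, hXt] at this
      linarith
    have hder := hX t ⟨by linarith, by linarith⟩
    rw [max_eq_left ht.le, hXt] at hder
    have hchord := tendsto_backward_chord hder
    obtain ⟨σ, -, U, hU, hUp⟩ := hαξ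
    have hback : Tendsto (fun r : ℝ => t - r) (𝓝[>] 0) (𝓝 t) :=
      (Continuous.tendsto' (by fun_prop) _ _ (by simp)).mono_left nhdsWithin_le_nhds
    have hU' : U ∈ 𝓝 (t, x) := by
      rwa [nhdsWithin_eq_nhds.2 (prod_mem_nhds (Ici_mem_nhds ht) univ_mem)] at hU
    have hcurve : Tendsto (fun r : ℝ => (t - r, X (t - r))) (𝓝[>] 0) (𝓝 (t, x)) := by
      have := hder.continuousAt.tendsto
      rw [hXt] at this
      exact hback.prodMk_nhds (this.comp hback)
    have hlim : Tendsto (fun r : ℝ => α + inner ℝ ξ (r⁻¹ • (X t - X (t - r)))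
        + σ * r * (1 + ‖r⁻¹ • (X t - X (t - r))‖ ^ 2)) (𝓝[>] 0)
        (𝓝 (α + inner ℝ ξ (f t x u) + σ * 0 * (1 + ‖f t x u‖ ^ 2))) := by
      have hr : Tendsto (fun r : ℝ => r) (𝓝[>] 0) (𝓝 0) := nhdsWithin_le_nhds
      exact (tendsto_const_nhds.add (tendsto_const_nhds.inner hchord)).add
        ((tendsto_const_nhds.mul hr).mul (tendsto_const_nhds.add (hchord.norm.pow 2)))
    -- At `(t - r, X (t - r))` the proximal lower bound meets the upper bound `hmono`; after
    -- division by `r` the quadratic error tends to zero.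
    have hge := ge_of_tendsto (b := -c) hlim (by
      filter_upwards [Ioc_mem_nhdsGT hρ, Ioo_mem_nhdsGT ht, hcurve hU'] with r h1 h2 h3
      have h4 := hUp _ h3
      have h5 := hmono r h1.1 h1.2 h2.2
      set w := r⁻¹ • (X t - X (t - r)) with hw
      have h6 : X (t - r) - x = -(r • w) := by
        rw [hw, smul_inv_smul₀ h1.1.ne', hXt]; abel
      simp only [h6, sub_sub_cancel_left, norm_neg, norm_smul, mul_pow, Real.norm_eq_abs, sq_abs,
        inner_neg_right, inner_smul_right] at h4
      refine le_of_mul_le_mul_left (a := r) ?_ h1.1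
      linarith)
    linarith
  have := le_of_forall_gt_imp_ge_of_dense key
  simp only [preHamiltonian]
  linarith

end HamiltonJacobi

/-! ### The equivalences -/

theorem proposition4p1 {n m : ℕ} (δ : ℝ) (hδ : 0 < δ)
    (l : ℝ → EuclideanSpace ℝ (Fin n) → EuclideanSpace ℝ (Fin m) → ℝ)
    (f : ℝ → EuclideanSpace ℝ (Fin n) → EuclideanSpace ℝ (Fin m) → EuclideanSpace ℝ (Fin n))
    (Ω : Set (EuclideanSpace ℝ (Fin m))) (hΩ : Ω.Nonempty)
    (A1 : ∃ K₁ : ℝ, 0 < K₁ ∧ ∀ t : ℝ, 0 ≤ t → ∀ u ∈ Ω, ∀ x z : EuclideanSpace ℝ (Fin n),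
      |l t x u - l t z u| + ‖f t x u - f t z u‖ ≤ K₁ * ‖x - z‖)
    (A2 : ∃ K₂ : ℝ, 0 < K₂ ∧ ∀ t : ℝ, 0 ≤ t → ∀ x : EuclideanSpace ℝ (Fin n), ∀ u ∈ Ω,
      |l t x u| + ‖f t x u‖ ≤ K₂ * (1 + ‖x‖))
    (A3l : ContinuousOn
      (fun p : ℝ × EuclideanSpace ℝ (Fin n) × EuclideanSpace ℝ (Fin m) => l p.1 p.2.1 p.2.2)
      (Ici (0 : ℝ) ×ˢ univ))
    (A3f : ContinuousOn
      (fun p : ℝ × EuclideanSpace ℝ (Fin n) × EuclideanSpace ℝ (Fin m) => f p.1 p.2.1 p.2.2)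
      (Ici (0 : ℝ) ×ˢ univ))
    (A4 : ∀ t : ℝ, 0 ≤ t → ∀ x : EuclideanSpace ℝ (Fin n),
      Convex ℝ ((fun v => (Real.exp (-δ * t) * l t x v, f t x v)) '' Ω))
    (A5 : IsCompact Ω)
    (Φ : ℝ → EuclideanSpace ℝ (Fin n) → ℝ)
    (hΦ : ContinuousOn (fun p : ℝ × EuclideanSpace ℝ (Fin n) => Φ p.1 p.2)
      (Ici (0 : ℝ) ×ˢ univ)) :
    -- (a), over all points of `[0,∞) × ℝⁿ`
    ((∀ s : ℝ, 0 ≤ s → ∀ z : EuclideanSpace ℝ (Fin n),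
        (⨆ p ∈ proxSubgrad Φ s z, ((p.1 + hamiltonian δ l f Ω s z p.2 : ℝ) : EReal)) ≤ 0) ↔
      (∀ s : ℝ, 0 ≤ s → ∀ z : EuclideanSpace ℝ (Fin n),
        (⨆ p ∈ diniSubgrad Φ s z, ((p.1 + hamiltonian δ l f Ω s z p.2 : ℝ) : EReal)) ≤ 0)) ∧
    -- (a), over all points of `(0,∞) × ℝⁿ`
    ((∀ s : ℝ, 0 < s → ∀ z : EuclideanSpace ℝ (Fin n),
        (⨆ p ∈ proxSubgrad Φ s z, ((p.1 + hamiltonian δ l f Ω s z p.2 : ℝ) : EReal)) ≤ 0) ↔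
      (∀ s : ℝ, 0 < s → ∀ z : EuclideanSpace ℝ (Fin n),
        (⨆ p ∈ diniSubgrad Φ s z, ((p.1 + hamiltonian δ l f Ω s z p.2 : ℝ) : EReal)) ≤ 0)) ∧
    -- (b), over all points of `(0,∞) × ℝⁿ`
    ((∀ s : ℝ, 0 < s → ∀ z : EuclideanSpace ℝ (Fin n),
        0 ≤ (⨅ p ∈ proxSubgrad Φ s z, ((p.1 + hamiltonian δ l f Ω s z p.2 : ℝ) : EReal))) ↔
      (∀ s : ℝ, 0 < s → ∀ z : EuclideanSpace ℝ (Fin n),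
        0 ≤ (⨅ p ∈ diniSupergrad Φ s z, ((p.1 + hamiltonian δ l f Ω s z p.2 : ℝ) : EReal)))) ∧
    -- (b), with the Dini inequality over all points of `[0,∞) × ℝⁿ`
    ((∀ s : ℝ, 0 < s → ∀ z : EuclideanSpace ℝ (Fin n),
        0 ≤ (⨅ p ∈ proxSubgrad Φ s z, ((p.1 + hamiltonian δ l f Ω s z p.2 : ℝ) : EReal))) ↔
      (∀ s : ℝ, 0 ≤ s → ∀ z : EuclideanSpace ℝ (Fin n),
        0 ≤ (⨅ p ∈ diniSupergrad Φ s z, ((p.1 + hamiltonian δ l f Ω s z p.2 : ℝ) : EReal)))) := by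
  -- The velocity set is a linear projection of the convex set in `A4`.
  have hconv : ∀ s, 0 ≤ s → ∀ z, Convex ℝ (f s z '' Ω) := fun s hs z => by
    have := (A4 s hs z).linear_image (LinearMap.snd ℝ ℝ (EuclideanSpace ℝ (Fin n)))
    rwa [image_image] at this
  have hcoe₁ : ∀ a : ℝ, (a : EReal) ≤ 0 ↔ a ≤ 0 := fun a => by
    rw [← EReal.coe_zero, EReal.coe_le_coe_iff]
  have hcoe₂ : ∀ a : ℝ, 0 ≤ (a : EReal) ↔ 0 ≤ a := fun a => by
    rw [← EReal.coe_zero, EReal.coe_le_coe_iff]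
  simp only [iSup_le_iff, le_iInf_iff, hcoe₁, hcoe₂]
  refine ⟨⟨fun h s hs z p hp => ?_, fun h s hs z p hp => ?_⟩,
    ⟨fun h s hs z p hp => ?_, fun h s hs z p hp => ?_⟩,
    ⟨fun h s hs z p hp => ?_, fun h s hs z p hp => ?_⟩,
    ⟨fun h s hs z p hp => ?_, fun h s hs z p hp => ?_⟩⟩
  · exact add_hamiltonian_nonpos_of_mem_diniSubgrad hΩ A3l A3f A5 hΦ hs (hconv s hs z)
      (fun s' hs' _ => h s' hs') hp
  · exact h s hs z p (proxSubgrad_subset_diniSubgrad hp)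
  · exact add_hamiltonian_nonpos_of_mem_diniSubgrad hΩ A3l A3f A5 hΦ hs.le (hconv s hs.le z)
      (fun s' _ hs' => h s' (hs' hs)) hp
  · exact h s hs z p (proxSubgrad_subset_diniSubgrad hp)
  · exact add_hamiltonian_nonneg_of_mem_diniSupergrad hΩ A1 A3l A3f A5 hΦ h hs.le hp
  · exact add_hamiltonian_nonneg_of_mem_proxSubgrad hΩ A1 A3l A3f A5 hΦ h hs hp
  · exact add_hamiltonian_nonneg_of_mem_diniSupergrad hΩ A1 A3l A3f A5 hΦ h hs hp
  · exact add_hamiltonian_nonneg_of_mem_proxSubgrad hΩ A1 A3l A3f A5 hΦ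
      (fun s' hs' => h s' hs'.le) hs hp
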